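/- Let $M$ be a real, smooth, oriented 4-dimensional (Hausdorff) manifold with a smooth metric $g$ of arbitrary signature, and let $s$ be the number of minus signs in the signature. A complex 2-form $W$ is self-dual (SD) if ${}^*W=\sqrt{(-1)^s}\,W$ and anti-self-dual (ASD) if ${}^*W=-\sqrt{(-1)^s}\,W$, where ${}^*$ is the Hodge star and $\sqrt{-1}=i$. A para-Hermitian structure at $x\in M$ is a complex-linear endomorphism $K_x$ of $T_xM\otimes\mathbb{C}$ with $K_x^2=\mathbb{I}$, with $\pm1$-eigenspaces of equal dimension, and with $g(K_xX,K_xY)=-g(X,Y)$ for all $X,Y$; it has positive (negative) chirality if the 2-form $g(K_x\,\cdot\,,\cdot)$ is SD (ASD). An almost para-Hermitian structure on an open set $U\subseteq M$ is a smooth field $K$ of such endomorphisms on $U$, and it is half-integrable if at least one of its two eigenbundles $\{K=+1\}$, $\{K=-1\}\subset TU\otimes\mathbb{C}$ is involutive, i.e. closed under the Lie bracket of smooth complex vector fields. Fix one of the two chiralities. Suppose that every para-Hermitian structure of that chirality, at every point, belongs to a half-integrable one: for every $x\in M$ and every para-Hermitian structure $K_x$ of the fixed chirality at $x$ there are an open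 neighbourhood $U$ of $x$ and a half-integrable almost para-Hermitian structure $K$ on $U$ whose value at $x$ is $K_x$. Then the Weyl curvature $C$ of $g$ has the opposite duality on all of $M$: it is SD, $\tfrac12\varepsilon_{ab}{}^{ef}C_{efcd}=\sqrt{(-1)^s}\,C_{abcd}$, if the fixed chirality is negative, and ASD, $\tfrac12\varepsilon_{ab}{}^{ef}C_{efcd}=-\sqrt{(-1)^s}\,C_{abcd}$, if it is positive. -/

import Mathlib

open scoped Manifold ContDiff TensorProduct Topology

noncomputable section

namespace ParaHermitian

/-- The model space of a real 4-manifold. -/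
abbrev E4 : Type := EuclideanSpace ℝ (Fin 4)

/-- The standard basis of the model space. -/
def stdBasis : Module.Basis (Fin 4) ℝ E4 := (EuclideanSpace.basisFun (Fin 4) ℝ).toBasis

/-! ### Pointwise notions -/

section Complexification

variable {V : Type*} [AddCommGroup V] [Module ℝ V]

/-- The real part `V ⊗ ℂ → V`, `z ⊗ v ↦ (Re z) v`. -/
def rePart : ℂ ⊗[ℝ] V →ₗ[ℝ] V :=
  (TensorProduct.lid ℝ V).toLinearMap ∘ₗ Complex.reLm.rTensor V

/-- The imaginary part `V ⊗ ℂ → V`, `z ⊗ v ↦ (Im z) v`. -/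
def imPart : ℂ ⊗[ℝ] V →ₗ[ℝ] V :=
  (TensorProduct.lid ℝ V).toLinearMap ∘ₗ Complex.imLm.rTensor V

/-- The complex vector `v + i w`. -/
def mkComplex (v w : V) : ℂ ⊗[ℝ] V := (1 : ℂ) ⊗ₜ[ℝ] v + Complex.I ⊗ₜ[ℝ] w

theorem mkComplex_rePart_imPart (z : ℂ ⊗[ℝ] V) : mkComplex (rePart z) (imPart z) = z := by
  induction z using TensorProduct.induction_on with
  | zero => simp [mkComplex]
  | tmul c v =>
    have h : c = c.re • (1 : ℂ) + c.im • Complex.I := by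
      apply Complex.ext <;> simp
    have h1 : (rePart (c ⊗ₜ[ℝ] v) : V) = c.re • v := by simp [rePart]
    have h2 : (imPart (c ⊗ₜ[ℝ] v) : V) = c.im • v := by simp [imPart]
    rw [h1, h2, mkComplex, ← TensorProduct.smul_tmul, ← TensorProduct.smul_tmul,
      ← TensorProduct.add_tmul, ← h]
  | add x y hx hy =>
    rw [map_add, map_add]
    conv_rhs => rw [← hx, ← hy]
    simp only [mkComplex, TensorProduct.tmul_add]
    abel

/-- `(B, K)` is a para-Hermitian structure on the complex vector space `W`. -/
structure IsParaHermitian {W : Type*} [AddCommGroup W] [Module ℂ W]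
    (B : LinearMap.BilinForm ℂ W) (K : Module.End ℂ W) : Prop where
  sq_eq_one : K * K = 1
  rank_eq : Module.finrank ℂ (K.eigenspace 1) = Module.finrank ℂ (K.eigenspace (-1))
  anti_isometry : ∀ X Y : W, B (K X) (K Y) = -B X Y

end Complexification

variable {M : Type*} [TopologicalSpace M] [ChartedSpace E4 M]

/-- A vector field with values in `TM ⊗ ℂ`. -/
abbrev ComplexField (M : Type*) [TopologicalSpace M] [ChartedSpace E4 M] : Type _ :=
  ∀ x : M, ℂ ⊗[ℝ] TangentSpace (𝓡 4) x

/-- A field of endomorphisms of `TM ⊗ ℂ`. -/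
abbrev ComplexEndField (M : Type*) [TopologicalSpace M] [ChartedSpace E4 M] : Type _ :=
  ∀ x : M, Module.End ℂ (ℂ ⊗[ℝ] TangentSpace (𝓡 4) x)

/-- The standard basis of `T_x M`, which is the coordinate basis at `x` of the preferred chart
at `x`. -/
def tangentBasis (x : M) : Module.Basis (Fin 4) ℝ (TangentSpace (𝓡 4) x) := stdBasis

section Smooth

variable [IsManifold (𝓡 4) ∞ M]

/-- A smooth metric of arbitrary signature: a smooth field of nondegenerate symmetric bilinear
forms on the tangent spaces. -/
structure PseudoMetric (M : Type*) [TopologicalSpace M] [ChartedSpace E4 M]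
    [IsManifold (𝓡 4) ∞ M] where
  val : ∀ x : M, TangentSpace (𝓡 4) x →L[ℝ] TangentSpace (𝓡 4) x →L[ℝ] ℝ
  symm : ∀ (x : M) (v w : TangentSpace (𝓡 4) x), val x v w = val x w v
  nondegenerate : ∀ (x : M) (v : TangentSpace (𝓡 4) x), (∀ w, val x v w = 0) → v = 0
  contMDiff : ContMDiff (𝓡 4) ((𝓡 4).prod 𝓘(ℝ, E4 →L[ℝ] E4 →L[ℝ] ℝ)) ∞
    (fun x ↦ Bundle.TotalSpace.mk' (E4 →L[ℝ] E4 →L[ℝ] ℝ) x (val x))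

/-- An orientation of the manifold: a choice of orientation of every tangent space which is
locally constant in the standard local trivializations of the tangent bundle. -/
structure ManifoldOrientation (M : Type*) [TopologicalSpace M] [ChartedSpace E4 M]
    [IsManifold (𝓡 4) ∞ M] where
  val : ∀ x : M, Orientation ℝ (TangentSpace (𝓡 4) x) (Fin 4)
  locally_constant : ∀ x₀ : M, ∀ᶠ x in 𝓝 x₀,
    ∀ hx : x ∈ (trivializationAt E4 (TangentSpace (𝓡 4) : M → Type _) x₀).baseSet,
      Orientation.map (Fin 4)
        ((trivializationAt E4 (TangentSpace (𝓡 4) : M → Type _) x₀).continuousLinearEquivAt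
          ℝ x hx).toLinearEquiv (val x) = (val x₀ : Orientation ℝ E4 (Fin 4))

/-- The metric at `x`, extended complex-bilinearly to `T_x M ⊗ ℂ`. -/
def PseudoMetric.complexified (g : PseudoMetric M) (x : M) :
    LinearMap.BilinForm ℂ (ℂ ⊗[ℝ] TangentSpace (𝓡 4) x) :=
  (g.val x).toBilinForm.baseChange ℂ

/-- The matrix `g_{ab}` of the metric at `x`. -/
def PseudoMetric.gram (g : PseudoMetric M) (x : M) : Matrix (Fin 4) (Fin 4) ℝ :=
  Matrix.of fun a b ↦ g.val x (tangentBasis x a) (tangentBasis x b)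

/-! ### The Hodge star on 2-forms -/

open Classical in
/-- The metric volume form of the oriented space `T_x M`. -/
def volumeForm (g : PseudoMetric M) (o : ManifoldOrientation M) (x : M) :
    TangentSpace (𝓡 4) x [⋀^Fin 4]→ₗ[ℝ] ℝ :=
  ((if (tangentBasis x).orientation = o.val x then (1 : ℝ) else -1) *
    Real.sqrt |(g.gram x).det|) • (tangentBasis x).det

/-- The Hodge star on complex 2-forms at `x`, in components:
`(*W)_{ab} = ½ ε_{abcd} g^{ce} g^{df} W_{ef}`. -/
def hodge (g : PseudoMetric M) (o : ManifoldOrientation M) (x : M) (W : Fin 4 → Fin 4 → ℂ) :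
    Fin 4 → Fin 4 → ℂ := fun a b ↦
  (1 / 2 : ℂ) * ∑ c, ∑ d, ∑ e, ∑ f,
    ((volumeForm g o x ![tangentBasis x a, tangentBasis x b, tangentBasis x c, tangentBasis x d] *
      (g.gram x)⁻¹ c e * (g.gram x)⁻¹ d f : ℝ) : ℂ) * W e f

/-- The number `√((-1)^s)`, where `s` is the number of minus signs in the signature of the metric
at `x`; note that `(-1)^s` is the sign of the determinant of the metric. -/
def sdEigenvalue (g : PseudoMetric M) (x : M) : ℂ :=
  if 0 < (g.gram x).det then 1 else Complex.I

/-- The two chiralities: `positive` for self-dual, `negative` for anti-self-dual. -/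
inductive Chirality
  | positive
  | negative

/-- The opposite chirality. -/
def Chirality.opposite : Chirality → Chirality
  | .positive => .negative
  | .negative => .positive

/-- The sign `±1` of a chirality. -/
def Chirality.sign : Chirality → ℂ
  | .positive => 1
  | .negative => -1

/-- A complex 2-form at `x` (in components) is self-dual (`*W = √((-1)^s) W`) if `χ` is positive,
anti-self-dual (`*W = -√((-1)^s) W`) if `χ` is negative. -/
def IsDual (g : PseudoMetric M) (o : ManifoldOrientation M) (χ : Chirality) (x : M)
    (W : Fin 4 → Fin 4 → ℂ) : Prop :=
  ∀ a b, hodge g o x W a b = χ.sign * sdEigenvalue g x * W a b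

/-! ### Almost para-Hermitian structures -/

/-- The components of the 2-form `ω(X, Y) = g(K X, Y)`. -/
def fundamentalForm (g : PseudoMetric M) (x : M)
    (K : Module.End ℂ (ℂ ⊗[ℝ] TangentSpace (𝓡 4) x)) : Fin 4 → Fin 4 → ℂ := fun a b ↦
  g.complexified x (K (1 ⊗ₜ[ℝ] tangentBasis x a)) (1 ⊗ₜ[ℝ] tangentBasis x b)

/-- `K` is a para-Hermitian structure on `T_x M ⊗ ℂ` of chirality `χ`: its fundamental 2-form is
self-dual for positive and anti-self-dual for negative chirality. -/
def IsParaHermitianAt (g : PseudoMetric M) (o : ManifoldOrientation M) (χ : Chirality) (x : M)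
    (K : Module.End ℂ (ℂ ⊗[ℝ] TangentSpace (𝓡 4) x)) : Prop :=
  IsParaHermitian (g.complexified x) K ∧ IsDual g o χ x (fundamentalForm g x K)

/-- A real vector field is smooth on `U`. -/
def SmoothOn (U : Set M) (X : ∀ x : M, TangentSpace (𝓡 4) x) : Prop :=
  ContMDiffOn (𝓡 4) (𝓡 4).tangent ∞ (fun x ↦ (⟨x, X x⟩ : TangentBundle (𝓡 4) M)) U

/-- A complex vector field is smooth on `U`. -/
def ComplexSmoothOn (U : Set M) (X : ComplexField M) : Prop :=
  SmoothOn U (fun x ↦ rePart (X x)) ∧ SmoothOn U (fun x ↦ imPart (X x))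

/-- A field of endomorphisms of `TM ⊗ ℂ` is smooth on `U`: it maps smooth complex vector fields on
open subsets of `U` to smooth ones. -/
def EndSmoothOn (U : Set M) (K : ComplexEndField M) : Prop :=
  ∀ V : Set M, IsOpen V → V ⊆ U → ∀ X : ComplexField M,
    ComplexSmoothOn V X → ComplexSmoothOn V (fun x ↦ K x (X x))

/-- `(g, K)` is an almost para-Hermitian structure on the open set `U`. -/
structure IsAlmostParaHermitianOn (g : PseudoMetric M) (U : Set M) (K : ComplexEndField M) :
    Prop where
  smooth : EndSmoothOn U K
  paraHermitian : ∀ x ∈ U, IsParaHermitian (g.complexified x) (K x)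

/-- The Lie bracket of complex vector fields, the complex-bilinear extension of the Lie bracket
of real ones. -/
def complexBracket (X Y : ComplexField M) : ComplexField M := fun x ↦
  mkComplex
    (VectorField.mlieBracket (𝓡 4) (fun p ↦ rePart (X p)) (fun p ↦ rePart (Y p)) x -
      VectorField.mlieBracket (𝓡 4) (fun p ↦ imPart (X p)) (fun p ↦ imPart (Y p)) x)
    (VectorField.mlieBracket (𝓡 4) (fun p ↦ rePart (X p)) (fun p ↦ imPart (Y p)) x +
      VectorField.mlieBracket (𝓡 4) (fun p ↦ imPart (X p)) (fun p ↦ rePart (Y p)) x)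

/-- A distribution `L ⊆ TM ⊗ ℂ` on `U` is involutive: the Lie bracket of two smooth (local)
sections of `L` is a section of `L`. -/
def InvolutiveOn (U : Set M) (L : ∀ x : M, Submodule ℂ (ℂ ⊗[ℝ] TangentSpace (𝓡 4) x)) : Prop :=
  ∀ V : Set M, IsOpen V → V ⊆ U → ∀ X Y : ComplexField M,
    ComplexSmoothOn V X → ComplexSmoothOn V Y →
    (∀ x ∈ V, X x ∈ L x) → (∀ x ∈ V, Y x ∈ L x) → ∀ x ∈ V, complexBracket X Y x ∈ L x

/-- `K` is half-integrable on `U`: one of its eigenbundles is involutive. -/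
def HalfIntegrableOn (U : Set M) (K : ComplexEndField M) : Prop :=
  InvolutiveOn U (fun x ↦ (K x).eigenspace 1) ∨ InvolutiveOn U (fun x ↦ (K x).eigenspace (-1))

/-! ### Curvature in a chart -/

/-- The components `g_{ij}` of the metric in the preferred chart at `p`, as functions of the
coordinates `y`. -/
def coordMetric (g : PseudoMetric M) (p : M) (y : E4) : Matrix (Fin 4) (Fin 4) ℝ :=
  Matrix.of fun i j ↦
    g.val ((extChartAt (𝓡 4) p).symm y)
      (mfderiv 𝓘(ℝ, E4) (𝓡 4) (extChartAt (𝓡 4) p).symm y (stdBasis i))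
      (mfderiv 𝓘(ℝ, E4) (𝓡 4) (extChartAt (𝓡 4) p).symm y (stdBasis j))

end Smooth

/-- The partial derivative `∂_i f` at `y`. -/
def pderiv (i : Fin 4) (f : E4 → ℝ) (y : E4) : ℝ := fderiv ℝ f y (stdBasis i)

/-- The Christoffel symbols `Γ^k_{ij}` of the Levi-Civita connection of `G`. -/
def christoffel (G : E4 → Matrix (Fin 4) (Fin 4) ℝ) (k i j : Fin 4) (y : E4) : ℝ :=
  (1 / 2) * ∑ l, (G y)⁻¹ k l *
    (pderiv i (fun z ↦ G z j l) y + pderiv j (fun z ↦ G z i l) y - pderiv l (fun z ↦ G z i j) y)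

/-- The curvature `R^l_{kij}`, where `R(∂_i, ∂_j) ∂_k = R^l_{kij} ∂_l`. -/
def riemannUp (G : E4 → Matrix (Fin 4) (Fin 4) ℝ) (l k i j : Fin 4) (y : E4) : ℝ :=
  pderiv i (christoffel G l j k) y - pderiv j (christoffel G l i k) y +
    ∑ m, (christoffel G l i m y * christoffel G m j k y -
      christoffel G l j m y * christoffel G m i k y)

/-- The Riemann tensor `R_{abcd} = g_{am} R^m_{bcd}`. -/
def riemann (G : E4 → Matrix (Fin 4) (Fin 4) ℝ) (a b c d : Fin 4) (y : E4) : ℝ :=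
  ∑ m, G y a m * riemannUp G m b c d y

/-- The Ricci tensor `R_{ab} = R^m_{amb}`. -/
def ricci (G : E4 → Matrix (Fin 4) (Fin 4) ℝ) (a b : Fin 4) (y : E4) : ℝ :=
  ∑ m, riemannUp G m a m b y

/-- The scalar curvature `g^{ab} R_{ab}`. -/
def scalarCurvature (G : E4 → Matrix (Fin 4) (Fin 4) ℝ) (y : E4) : ℝ :=
  ∑ a, ∑ b, (G y)⁻¹ a b * ricci G a b y

/-- The Weyl tensor `C_{abcd}` of a metric in dimension four. -/
def weylCoord (G : E4 → Matrix (Fin 4) (Fin 4) ℝ) (a b c d : Fin 4) (y : E4) : ℝ :=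
  riemann G a b c d y -
    (1 / 2) * (G y a c * ricci G b d y - G y a d * ricci G b c y
      - G y b c * ricci G a d y + G y b d * ricci G a c y) +
    (scalarCurvature G y / 6) * (G y a c * G y b d - G y a d * G y b c)

/-- The components at `x`, in the basis `tangentBasis x`, of the Weyl tensor of `g`; they are
computed in the preferred chart at `x`, whose coordinate basis at `x` is `tangentBasis x`. -/
def weyl [IsManifold (𝓡 4) ∞ M] (g : PseudoMetric M) (x : M) (a b c d : Fin 4) : ℝ :=
  weylCoord (coordMetric g x) a b c d (extChartAt (𝓡 4) x x)

/-- The Weyl curvature of `g` is self-dual (`χ` positive) or anti-self-dual (`χ` negative):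
`½ ε_{ab}^{ef} C_{efcd} = ± √((-1)^s) C_{abcd}` everywhere. -/
def WeylIsDual [IsManifold (𝓡 4) ∞ M] (g : PseudoMetric M) (o : ManifoldOrientation M)
    (χ : Chirality) : Prop :=
  ∀ (x : M) (c d : Fin 4), IsDual g o χ x (fun a b ↦ (weyl g x a b c d : ℂ))

end ParaHermitian

end

/-!
The `±1`-eigenspaces of a para-Hermitian structure `K` are totally null planes, each its own
orthogonal complement, and the chirality of `K` says in which of the two families of complex null
planes they lie. The theorem is the combination of one fact from differential geometry and one
from algebra.

*Geometry.* If `L` is an involutive totally null distribution with `L^⊥ = L`, then its leaves are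
totally geodesic: for sections `A`, `B`, `C` of `L` the expression `g(∇_A B, C)` is symmetric in
`A, B` since `[A, B] ∈ L`, and skew-symmetric in `B, C` since `g(B, C) = 0`, hence zero
(`IsNullInvolutiveAt.pair_covDir_eq_zero`). So `∇` restricts to `L` and `g(R(X, Y) Z, W) = 0` on `L`
(`IsNullInvolutiveAt.pair_curvature_eq_zero`, applied to an eigenbundle in
`sum_riemann_eq_zero`). On a totally null plane the Riemann and the Weyl tensor agree
(`sum_weylCoord_eq_sum_riemann`), so `C(X, Y, X, Y) = 0` on an involutive eigenbundle
(`quad_weyl_eq_zero`).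

*Algebra.* In a complex null frame `(l, n, m, m')` with `g(l, n) = g(m, m') = 1`, oriented according
to the given chirality (`exists_adaptedFrame`), the planes of one family are, except for one, the
spans of `l + t m'` and `m - t n` with `t ∈ ℂ`. For `t ≠ s` the endomorphism with eigenplanes `t`
and `s` is a para-Hermitian structure of that chirality (`isParaHermitianAt_paraMatrix`), so by
hypothesis one of its two eigenplanes is the value of an involutive eigenbundle, and the polynomial
`Q(t) = C(l + t m', m - t n, l + t m', m - t n)` of degree at most four vanishes at `t` or at `s`.
As one of any two of its values is zero, `Q = 0` (`quartic_coeff_eq_zero`). Together with the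
Bianchi identity and the vanishing of the trace, the five coefficients of `Q` determine the part of
`C` acting on the bivectors of the family, so this part vanishes
(`IsWeylTensor.components_eq_zero`): `C` has the opposite duality (`nullHodge_frame_eq_self`,
`hodge_eq_of_nullHodge`).
-/

noncomputable section

namespace ParaHermitian

/-! ### Covariant derivatives of complex vector fields in coordinates -/

/-- The partial derivative `∂_i f` at `y` of a complex-valued function. -/
def cpderiv (i : Fin 4) (f : E4 → ℂ) (y : E4) : ℂ := fderiv ℝ f y (stdBasis i)

theorem cpderiv_congr {f h : E4 → ℂ} {y : E4} (i : Fin 4) (H : f =ᶠ[𝓝 y] h) :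
    cpderiv i f y = cpderiv i h y := by
  rw [cpderiv, cpderiv, H.fderiv_eq]

theorem cpderiv_eq_zero {f : E4 → ℂ} {y : E4} (i : Fin 4) (H : ∀ᶠ z in 𝓝 y, f z = 0) :
    cpderiv i f y = 0 := by
  rw [cpderiv_congr (h := fun _ ↦ 0) i H]
  simp [cpderiv]

theorem cpderiv_add {f h : E4 → ℂ} {y : E4} (i : Fin 4) (hf : DifferentiableAt ℝ f y)
    (hh : DifferentiableAt ℝ h y) :
    cpderiv i (fun z ↦ f z + h z) y = cpderiv i f y + cpderiv i h y := by
  simp only [cpderiv]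
  rw [fderiv_fun_add hf hh]
  rfl

theorem cpderiv_mul {f h : E4 → ℂ} {y : E4} (i : Fin 4) (hf : DifferentiableAt ℝ f y)
    (hh : DifferentiableAt ℝ h y) :
    cpderiv i (fun z ↦ f z * h z) y = cpderiv i f y * h y + f y * cpderiv i h y := by
  simp only [cpderiv]
  rw [fderiv_fun_mul hf hh]
  simp [mul_comm, add_comm]

theorem cpderiv_sum {ι : Type*} {f : ι → E4 → ℂ} {y : E4} (i : Fin 4) (s : Finset ι)
    (hf : ∀ a ∈ s, DifferentiableAt ℝ (f a) y) :
    cpderiv i (fun z ↦ ∑ a ∈ s, f a z) y = ∑ a ∈ s, cpderiv i (f a) y := by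
  simp only [cpderiv]
  rw [fderiv_fun_sum hf]
  simp

theorem cpderiv_ofReal {f : E4 → ℝ} {y : E4} (i : Fin 4) (hf : DifferentiableAt ℝ f y) :
    cpderiv i (fun z ↦ (f z : ℂ)) y = (pderiv i f y : ℂ) := by
  have h : HasFDerivAt (fun z ↦ (f z : ℂ)) (Complex.ofRealCLM.comp (fderiv ℝ f y)) y :=
    Complex.ofRealCLM.hasFDerivAt.comp y hf.hasFDerivAt
  rw [cpderiv, h.fderiv]
  rfl

theorem differentiableAt_cpderiv {f : E4 → ℂ} {y : E4} (i : Fin 4) (hf : ContDiffAt ℝ 2 f y) :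
    DifferentiableAt ℝ (cpderiv i f) y := by
  have h : ContDiffAt ℝ 1 (fderiv ℝ f) y := hf.fderiv_right (by norm_num)
  exact (h.differentiableAt (by norm_num)).clm_apply (differentiableAt_const _)

theorem cpderiv_comm {f : E4 → ℂ} {y : E4} (i j : Fin 4) (hf : ContDiffAt ℝ 2 f y) :
    cpderiv i (cpderiv j f) y = cpderiv j (cpderiv i f) y := by
  have h : ContDiffAt ℝ 1 (fderiv ℝ f) y := hf.fderiv_right (by norm_num)
  have hd := h.differentiableAt (by norm_num)
  have key : ∀ a b, cpderiv a (cpderiv b f) y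
      = fderiv ℝ (fderiv ℝ f) y (stdBasis a) (stdBasis b) := by
    intro a b
    change fderiv ℝ (fun z ↦ fderiv ℝ f z (stdBasis b)) y (stdBasis a) = _
    rw [fderiv_clm_apply hd (differentiableAt_const _)]
    simp
  rw [key, key]
  exact (hf.isSymmSndFDerivAt (by simp)) _ _

theorem eventually_differentiableAt_of_contDiffAt_two {f : E4 → ℂ} {y : E4}
    (hf : ContDiffAt ℝ 2 f y) : ∀ᶠ z in 𝓝 y, DifferentiableAt ℝ f z :=
  (hf.eventually (by simp)).mono fun _ h ↦ h.differentiableAt (by norm_num)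

/-- The bilinear form with coefficients `q`. -/
def pair (q : Fin 4 → Fin 4 → ℂ) (u v : Fin 4 → ℂ) : ℂ := ∑ a, ∑ b, q a b * u a * v b

theorem pair_comm {q : Fin 4 → Fin 4 → ℂ} (hq : ∀ a b, q a b = q b a) (u v : Fin 4 → ℂ) :
    pair q u v = pair q v u := by
  simp only [pair]
  rw [Finset.sum_comm]
  refine Finset.sum_congr rfl fun a _ ↦ Finset.sum_congr rfl fun b _ ↦ ?_
  rw [hq]; ring

theorem pair_sub_left (q : Fin 4 → Fin 4 → ℂ) (u u' v : Fin 4 → ℂ) :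
    pair q (fun a ↦ u a - u' a) v = pair q u v - pair q u' v := by
  simp only [pair, ← Finset.sum_sub_distrib]
  refine Finset.sum_congr rfl fun a _ ↦ Finset.sum_congr rfl fun b _ ↦ ?_
  ring

theorem pair_sum_smul_left (q : Fin 4 → Fin 4 → ℂ) (c : Fin 4 → ℂ) (u : Fin 4 → Fin 4 → ℂ)
    (v : Fin 4 → ℂ) :
    pair q (fun a ↦ ∑ i, c i * u i a) v = ∑ i, c i * pair q (u i) v := by
  simp only [pair, Finset.mul_sum, Finset.sum_mul]
  conv_rhs => rw [Finset.sum_comm]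
  refine Finset.sum_congr rfl fun a _ ↦ ?_
  rw [Finset.sum_comm]
  refine Finset.sum_congr rfl fun i _ ↦ Finset.sum_congr rfl fun b _ ↦ ?_
  ring

theorem pair_sum_smul_right (q : Fin 4 → Fin 4 → ℂ) (c : Fin 4 → ℂ) (u : Fin 4 → Fin 4 → ℂ)
    (v : Fin 4 → ℂ) :
    pair q v (fun a ↦ ∑ i, c i * u i a) = ∑ i, c i * pair q v (u i) := by
  have := pair_sum_smul_left (fun a b ↦ q b a) c u v
  have h : ∀ w, pair (fun a b ↦ q b a) w v = pair q v w := by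
    intro w
    simp only [pair]
    rw [Finset.sum_comm]
    refine Finset.sum_congr rfl fun a _ ↦ Finset.sum_congr rfl fun b _ ↦ ?_
    ring
  simpa only [h] using this

/-- The covariant derivative `(∇_i A)^k = ∂_i A^k + Γ^k_{ij} A^j` of a complex vector field. -/
def covDeriv (Γ : Fin 4 → Fin 4 → Fin 4 → E4 → ℂ) (i : Fin 4) (A : Fin 4 → E4 → ℂ) (k : Fin 4)
    (y : E4) : ℂ :=
  cpderiv i (A k) y + ∑ j, Γ k i j y * A j y

/-- The covariant derivative `∇_X A = X^i ∇_i A`. -/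
def covDir (Γ : Fin 4 → Fin 4 → Fin 4 → E4 → ℂ) (X A : Fin 4 → E4 → ℂ) (k : Fin 4)
    (y : E4) : ℂ :=
  ∑ i, X i y * covDeriv Γ i A k y

/-- The Lie bracket of complex vector fields in coordinates. -/
def coordBracket (X Y : Fin 4 → E4 → ℂ) (k : Fin 4) (y : E4) : ℂ :=
  ∑ i, (X i y * cpderiv i (Y k) y - Y i y * cpderiv i (X k) y)

/-- The curvature `R^l_{kij}` of the connection with Christoffel symbols `Γ`. -/
def curvature (Γ : Fin 4 → Fin 4 → Fin 4 → E4 → ℂ) (l k i j : Fin 4) (y : E4) : ℂ :=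
  cpderiv i (Γ l j k) y - cpderiv j (Γ l i k) y +
    ∑ m, (Γ l i m y * Γ m j k y - Γ l j m y * Γ m i k y)

/-- At `y`, the connection `Γ` is torsion-free and compatible with the metric `q`. -/
structure IsLeviCivitaAt (q : Fin 4 → Fin 4 → E4 → ℂ) (Γ : Fin 4 → Fin 4 → Fin 4 → E4 → ℂ)
    (y : E4) : Prop where
  symm : ∀ a b, q a b y = q b a y
  torsion : ∀ k i j, Γ k i j y = Γ k j i y
  compat : ∀ i a b, cpderiv i (q a b) y = ∑ l, (q l b y * Γ l i a y + q a l y * Γ l i b y)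
  diff_metric : ∀ a b, DifferentiableAt ℝ (q a b) y
  diff_symbol : ∀ k i j, DifferentiableAt ℝ (Γ k i j) y

section LeviCivita

variable {q : Fin 4 → Fin 4 → E4 → ℂ} {Γ : Fin 4 → Fin 4 → Fin 4 → E4 → ℂ} {y : E4}

theorem differentiableAt_covDeriv (h : IsLeviCivitaAt q Γ y) {A : Fin 4 → E4 → ℂ}
    (hA : ∀ k, ContDiffAt ℝ 2 (A k) y) (i k : Fin 4) :
    DifferentiableAt ℝ (covDeriv Γ i A k) y := by
  have := differentiableAt_cpderiv i (hA k)
  unfold covDeriv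
  refine this.add (DifferentiableAt.fun_sum fun j _ ↦ (h.diff_symbol _ _ _).mul ?_)
  exact (hA j).differentiableAt (by norm_num)

theorem differentiableAt_covDir (h : IsLeviCivitaAt q Γ y) {X A : Fin 4 → E4 → ℂ}
    (hX : ∀ k, DifferentiableAt ℝ (X k) y)
    (hA : ∀ k, ContDiffAt ℝ 2 (A k) y) (k : Fin 4) :
    DifferentiableAt ℝ (covDir Γ X A k) y := by
  unfold covDir
  exact DifferentiableAt.fun_sum fun i _ ↦ (hX i).mul (differentiableAt_covDeriv h hA i k)

/-- The Leibniz rule for `∂_i (q(A, B))`. -/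
theorem cpderiv_pair (h : IsLeviCivitaAt q Γ y) {A B : Fin 4 → E4 → ℂ}
    (hA : ∀ k, DifferentiableAt ℝ (A k) y) (hB : ∀ k, DifferentiableAt ℝ (B k) y) (i : Fin 4) :
    cpderiv i (fun z ↦ pair (fun a b ↦ q a b z) (fun a ↦ A a z) (fun a ↦ B a z)) y =
      pair (fun a b ↦ q a b y) (fun a ↦ covDeriv Γ i A a y) (fun a ↦ B a y) +
      pair (fun a b ↦ q a b y) (fun a ↦ A a y) (fun a ↦ covDeriv Γ i B a y) := by
  have hq := h.diff_metric
  have e : cpderiv i (fun z ↦ pair (fun a b ↦ q a b z) (fun a ↦ A a z) (fun a ↦ B a z)) y =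
      ∑ a, ∑ b, (cpderiv i (q a b) y * A a y * B b y + q a b y * cpderiv i (A a) y * B b y +
        q a b y * A a y * cpderiv i (B b) y) := by
    simp only [pair]
    rw [cpderiv_sum _ _ fun a _ ↦ DifferentiableAt.fun_sum fun b _ ↦
      ((hq a b).fun_mul (hA a)).fun_mul (hB b)]
    refine Finset.sum_congr rfl fun a _ ↦ ?_
    rw [cpderiv_sum _ _ fun b _ ↦ ((hq a b).fun_mul (hA a)).fun_mul (hB b)]
    refine Finset.sum_congr rfl fun b _ ↦ ?_
    rw [cpderiv_mul _ ((hq a b).fun_mul (hA a)) (hB b), cpderiv_mul _ (hq a b) (hA a)]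
    ring
  rw [e]
  simp only [h.compat, pair, covDeriv, Finset.sum_add_distrib, mul_add, add_mul, Finset.sum_mul,
    Finset.mul_sum]
  have e1 : ∑ a, ∑ b, ∑ l, q l b y * Γ l i a y * A a y * B b y
      = ∑ a, ∑ b, ∑ l, q a b y * (Γ a i l y * A l y) * B b y := by
    rw [Finset.sum_comm]
    conv_rhs => rw [Finset.sum_comm]
    refine Finset.sum_congr rfl fun b _ ↦ ?_
    rw [Finset.sum_comm]
    refine Finset.sum_congr rfl fun a _ ↦ Finset.sum_congr rfl fun l _ ↦ ?_
    ring
  have e2 : ∑ a, ∑ b, ∑ l, q a l y * Γ l i b y * A a y * B b y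
      = ∑ a, ∑ b, ∑ l, q a b y * A a y * (Γ b i l y * B l y) := by
    refine Finset.sum_congr rfl fun a _ ↦ ?_
    rw [Finset.sum_comm]
    refine Finset.sum_congr rfl fun b _ ↦ Finset.sum_congr rfl fun l _ ↦ ?_
    ring
  rw [e1, e2]
  ring

/-- The connection is torsion-free: `∇_X Y - ∇_Y X = [X, Y]`. -/
theorem covDir_sub_covDir (h : IsLeviCivitaAt q Γ y) (X Y : Fin 4 → E4 → ℂ) (k : Fin 4) :
    covDir Γ X Y k y - covDir Γ Y X k y = coordBracket X Y k y := by
  simp only [covDir, covDeriv, coordBracket, mul_add, Finset.sum_add_distrib, Finset.mul_sum,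
    Finset.sum_sub_distrib]
  have : ∑ i, ∑ j, X i y * (Γ k i j y * Y j y) = ∑ i, ∑ j, Y i y * (Γ k i j y * X j y) := by
    rw [Finset.sum_comm]
    refine Finset.sum_congr rfl fun a _ ↦ Finset.sum_congr rfl fun b _ ↦ ?_
    rw [h.torsion]; ring
  rw [this]; ring

/-- The Ricci identity `[∇_i, ∇_j] Z = R(∂_i, ∂_j) Z`. -/
theorem covDeriv_covDeriv_sub (h : IsLeviCivitaAt q Γ y) {Z : Fin 4 → E4 → ℂ}
    (hZ : ∀ k, ContDiffAt ℝ 2 (Z k) y) (i j k : Fin 4) :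
    covDeriv Γ i (covDeriv Γ j Z) k y - covDeriv Γ j (covDeriv Γ i Z) k y =
      ∑ m, curvature Γ k m i j y * Z m y := by
  have hd : ∀ k, DifferentiableAt ℝ (Z k) y := fun k ↦ (hZ k).differentiableAt (by norm_num)
  have e : ∀ i j, covDeriv Γ i (covDeriv Γ j Z) k y = cpderiv i (cpderiv j (Z k)) y +
      ∑ m, (cpderiv i (Γ k j m) y * Z m y + Γ k j m y * cpderiv i (Z m) y) +
      ∑ m, Γ k i m y * cpderiv j (Z m) y + ∑ m, ∑ l, Γ k i l y * Γ l j m y * Z m y := by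
    intro i j
    have h1 : cpderiv i (covDeriv Γ j Z k) y = cpderiv i (cpderiv j (Z k)) y +
        ∑ m, (cpderiv i (Γ k j m) y * Z m y + Γ k j m y * cpderiv i (Z m) y) := by
      unfold covDeriv
      rw [cpderiv_add _ (differentiableAt_cpderiv j (hZ k))
        (DifferentiableAt.fun_sum fun l _ ↦ (h.diff_symbol _ _ _).fun_mul (hd l)),
        cpderiv_sum _ _ fun l _ ↦ (h.diff_symbol _ _ _).fun_mul (hd l)]
      congr 1
      exact Finset.sum_congr rfl fun l _ ↦ cpderiv_mul _ (h.diff_symbol _ _ _) (hd l)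
    rw [covDeriv, h1]
    simp only [covDeriv, mul_add, Finset.sum_add_distrib, Finset.mul_sum]
    rw [Finset.sum_comm (f := fun m l ↦ Γ k i m y * (Γ m j l y * Z l y))]
    simp only [mul_assoc]
    ring
  rw [e, e, cpderiv_comm i j (hZ k)]
  simp only [curvature, add_mul, sub_mul, Finset.sum_add_distrib, Finset.sum_sub_distrib,
    Finset.sum_mul]
  ring

/-- The second covariant derivative `∇_X ∇_Y Z` in components. -/
theorem covDir_covDir (h : IsLeviCivitaAt q Γ y) {X Y Z : Fin 4 → E4 → ℂ}
    (hY : ∀ k, DifferentiableAt ℝ (Y k) y) (hZ : ∀ k, ContDiffAt ℝ 2 (Z k) y) (k : Fin 4) :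
    covDir Γ X (covDir Γ Y Z) k y =
      ∑ i, ∑ j, X i y * cpderiv i (Y j) y * covDeriv Γ j Z k y +
      ∑ i, ∑ j, X i y * Y j y * covDeriv Γ i (covDeriv Γ j Z) k y := by
  simp only [covDir, ← Finset.sum_add_distrib]
  refine Finset.sum_congr rfl fun i _ ↦ ?_
  have h1 : cpderiv i (fun z ↦ ∑ j, Y j z * covDeriv Γ j Z k z) y =
      ∑ j, (cpderiv i (Y j) y * covDeriv Γ j Z k y + Y j y * cpderiv i (covDeriv Γ j Z k) y) := by
    rw [cpderiv_sum _ _ fun j _ ↦ (hY j).fun_mul (differentiableAt_covDeriv h hZ j k)]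
    exact Finset.sum_congr rfl fun j _ ↦ cpderiv_mul _ (hY j) (differentiableAt_covDeriv h hZ j k)
  have h2 : covDeriv Γ i (fun k z ↦ ∑ j, Y j z * covDeriv Γ j Z k z) k y =
      ∑ j, (cpderiv i (Y j) y * covDeriv Γ j Z k y + Y j y * cpderiv i (covDeriv Γ j Z k) y) +
      ∑ m, Γ k i m y * ∑ j, Y j y * covDeriv Γ j Z m y := by
    rw [covDeriv, h1]
  change X i y * covDeriv Γ i (fun k z ↦ ∑ j, Y j z * covDeriv Γ j Z k z) k y = _
  rw [h2]
  simp only [Finset.mul_sum, mul_add, Finset.sum_add_distrib]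
  rw [Finset.sum_comm (f := fun m j ↦ X i y * (Γ k i m y * (Y j y * covDeriv Γ j Z m y)))]
  simp only [← Finset.sum_add_distrib]
  refine Finset.sum_congr rfl fun j _ ↦ ?_
  conv_rhs => rw [show covDeriv Γ i (covDeriv Γ j Z) k y = cpderiv i (covDeriv Γ j Z k) y +
    ∑ m, Γ k i m y * covDeriv Γ j Z m y from rfl]
  rw [mul_add, Finset.mul_sum, ← add_assoc, add_assoc, add_assoc]
  congr 1
  · ring
  · congr 1
    · ring
    · exact Finset.sum_congr rfl fun m _ ↦ by ring

/-- The curvature operator `R(X, Y) Z = ∇_X ∇_Y Z - ∇_Y ∇_X Z - ∇_{[X, Y]} Z`. -/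
theorem sum_curvature_eq (h : IsLeviCivitaAt q Γ y) {X Y Z : Fin 4 → E4 → ℂ}
    (hX : ∀ k, DifferentiableAt ℝ (X k) y)
    (hY : ∀ k, DifferentiableAt ℝ (Y k) y) (hZ : ∀ k, ContDiffAt ℝ 2 (Z k) y) (k : Fin 4) :
    ∑ m, ∑ i, ∑ j, curvature Γ k m i j y * Z m y * X i y * Y j y =
      covDir Γ X (covDir Γ Y Z) k y - covDir Γ Y (covDir Γ X Z) k y -
        covDir Γ (coordBracket X Y) Z k y := by
  rw [covDir_covDir h hY hZ, covDir_covDir h hX hZ]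
  have e1 : ∑ i, ∑ j, Y i y * X j y * covDeriv Γ i (covDeriv Γ j Z) k y =
      ∑ i, ∑ j, X i y * Y j y * covDeriv Γ j (covDeriv Γ i Z) k y := by
    rw [Finset.sum_comm]
    exact Finset.sum_congr rfl fun i _ ↦ Finset.sum_congr rfl fun j _ ↦ by ring
  have e2 : covDir Γ (coordBracket X Y) Z k y =
      ∑ i, ∑ j, X i y * cpderiv i (Y j) y * covDeriv Γ j Z k y -
      ∑ i, ∑ j, Y i y * cpderiv i (X j) y * covDeriv Γ j Z k y := by
    simp only [covDir, coordBracket, Finset.sum_mul, sub_mul, Finset.sum_sub_distrib]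
    rw [Finset.sum_comm]
    conv_lhs => arg 2; rw [Finset.sum_comm]
  have e3 : ∑ m, ∑ i, ∑ j, curvature Γ k m i j y * Z m y * X i y * Y j y =
      ∑ i, ∑ j, X i y * Y j y * covDeriv Γ i (covDeriv Γ j Z) k y -
      ∑ i, ∑ j, X i y * Y j y * covDeriv Γ j (covDeriv Γ i Z) k y := by
    simp only [← Finset.sum_sub_distrib, ← mul_sub, covDeriv_covDeriv_sub h hZ, Finset.mul_sum]
    rw [Finset.sum_comm]
    refine Finset.sum_congr rfl fun i _ ↦ ?_
    rw [Finset.sum_comm]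
    exact Finset.sum_congr rfl fun j _ ↦ Finset.sum_congr rfl fun m _ ↦ by ring
  rw [e1, e2, e3]
  ring

/-! ### Involutive totally null distributions -/

/-- `S` is a family of local sections, near `y`, of a totally null distribution which is involutive
and whose fibre at `y` is its own orthogonal complement. -/
structure IsNullInvolutiveAt (q : Fin 4 → Fin 4 → E4 → ℂ) (S : Set (Fin 4 → E4 → ℂ)) (y : E4) :
    Prop where
  smooth : ∀ A ∈ S, ∀ k, ContDiffAt ℝ 2 (A k) y
  null : ∀ A ∈ S, ∀ B ∈ S, ∀ᶠ z in 𝓝 y,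
    pair (fun a b ↦ q a b z) (fun a ↦ A a z) (fun a ↦ B a z) = 0
  bracket : ∀ A ∈ S, ∀ B ∈ S, ∀ C ∈ S, ∀ᶠ z in 𝓝 y,
    pair (fun a b ↦ q a b z) (fun a ↦ coordBracket A B a z) (fun a ↦ C a z) = 0
  maximal : ∀ u : Fin 4 → ℂ, (∀ A ∈ S, pair (fun a b ↦ q a b y) u (fun a ↦ A a y) = 0) →
    ∃ B ∈ S, ∀ a, B a y = u a

/-- The leaves of an involutive totally null distribution are totally geodesic: `∇_A B` is
orthogonal to the distribution. The expression `q(∇_A B, C)` is symmetric in `A, B` and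
skew-symmetric in `B, C`, so it vanishes. -/
theorem IsNullInvolutiveAt.pair_covDir_eq_zero {S : Set (Fin 4 → E4 → ℂ)}
    (hS : IsNullInvolutiveAt q S y) (hLC : ∀ᶠ z in 𝓝 y, IsLeviCivitaAt q Γ z)
    {A B C : Fin 4 → E4 → ℂ} (hA : A ∈ S) (hB : B ∈ S) (hC : C ∈ S) :
    ∀ᶠ z in 𝓝 y,
      pair (fun a b ↦ q a b z) (fun a ↦ covDir Γ A B a z) (fun a ↦ C a z) = 0 := by
  have sym : ∀ A ∈ S, ∀ B ∈ S, ∀ C ∈ S, ∀ᶠ z in 𝓝 y,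
      pair (fun a b ↦ q a b z) (fun a ↦ covDir Γ A B a z) (fun a ↦ C a z) =
      pair (fun a b ↦ q a b z) (fun a ↦ covDir Γ B A a z) (fun a ↦ C a z) := by
    intro A hA B hB C hC
    filter_upwards [hLC, hS.bracket A hA B hB C hC] with z hz hb
    rw [← sub_eq_zero, ← pair_sub_left]
    simpa only [covDir_sub_covDir hz] using hb
  have skew : ∀ A ∈ S, ∀ B ∈ S, ∀ C ∈ S, ∀ᶠ z in 𝓝 y,
      pair (fun a b ↦ q a b z) (fun a ↦ covDir Γ A B a z) (fun a ↦ C a z) =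
      -pair (fun a b ↦ q a b z) (fun a ↦ covDir Γ A C a z) (fun a ↦ B a z) := by
    intro A hA B hB C hC
    filter_upwards [hLC, (hS.null B hB C hC).eventually_nhds,
      Filter.eventually_all.2 fun k ↦
        eventually_differentiableAt_of_contDiffAt_two (hS.smooth B hB k),
      Filter.eventually_all.2 fun k ↦
        eventually_differentiableAt_of_contDiffAt_two (hS.smooth C hC k)]
      with z hz hn hBd hCd
    simp only [covDir, pair_sum_smul_left, ← Finset.sum_neg_distrib]
    refine Finset.sum_congr rfl fun i _ ↦ ?_
    have := cpderiv_pair hz hBd hCd i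
    rw [cpderiv_eq_zero i hn, pair_comm hz.symm (fun a ↦ B a z)] at this
    linear_combination (-A i z) * this
  filter_upwards [skew A hA B hB C hC, sym A hA C hC B hB, skew C hC A hA B hB,
    sym C hC B hB A hA, skew B hB C hC A hA, sym B hB A hA C hC] with z h1 h2 h3 h4 h5 h6
  have : ∀ t : ℂ, t = -t → t = 0 := fun t ht ↦ by linear_combination (1 / 2 : ℂ) * ht
  apply this
  linear_combination h1 - h2 - h3 + h4 + h5 - h6

/-- The curvature vanishes on an involutive totally null distribution which is its own orthogonal
complement. -/
theorem IsNullInvolutiveAt.pair_curvature_eq_zero {S : Set (Fin 4 → E4 → ℂ)}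
    (hS : IsNullInvolutiveAt q S y) (hLC : ∀ᶠ z in 𝓝 y, IsLeviCivitaAt q Γ z)
    {X Y Z W : Fin 4 → E4 → ℂ} (hX : X ∈ S) (hY : Y ∈ S) (hZ : Z ∈ S) (hW : W ∈ S) :
    pair (fun a b ↦ q a b y)
      (fun k ↦ ∑ m, ∑ i, ∑ j, curvature Γ k m i j y * Z m y * X i y * Y j y)
      (fun a ↦ W a y) = 0 := by
  have h0 := hLC.self_of_nhds
  have hd : ∀ A ∈ S, ∀ k, DifferentiableAt ℝ (A k) y := fun A hA k ↦
    (hS.smooth A hA k).differentiableAt (by norm_num)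
  -- `∇_Y Z` lies in the fibre at `y`, so `q(∇_Y Z, ∇_X W) = 0`, and differentiating
  -- `q(∇_Y Z, W) = 0` along `X` gives `q(∇_X ∇_Y Z, W) = 0`
  have second : ∀ X ∈ S, ∀ Y ∈ S, pair (fun a b ↦ q a b y)
      (fun k ↦ covDir Γ X (covDir Γ Y Z) k y) (fun a ↦ W a y) = 0 := by
    intro X hX Y hY
    obtain ⟨B, hB, hBu⟩ := hS.maximal (fun a ↦ covDir Γ Y Z a y) fun A hA ↦
      (hS.pair_covDir_eq_zero hLC hY hZ hA).self_of_nhds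
    have key : pair (fun a b ↦ q a b y) (fun a ↦ covDir Γ Y Z a y) (fun a ↦ covDir Γ X W a y)
        = 0 := by
      rw [pair_comm h0.symm]
      simpa only [hBu] using (hS.pair_covDir_eq_zero hLC hX hW hB).self_of_nhds
    rw [show (fun a ↦ covDir Γ X W a y) = fun a ↦ ∑ i, X i y * covDeriv Γ i W a y from rfl,
      pair_sum_smul_right] at key
    rw [show (fun k ↦ covDir Γ X (covDir Γ Y Z) k y) = fun a ↦ ∑ i, X i y *
      covDeriv Γ i (covDir Γ Y Z) a y from rfl, pair_sum_smul_left]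
    refine Eq.trans (eq_sub_of_add_eq ?_) ((congrArg (fun t ↦ 0 - t) key).trans (sub_zero 0))
    rw [← Finset.sum_add_distrib]
    refine Finset.sum_eq_zero fun i _ ↦ ?_
    rw [← mul_add, ← cpderiv_pair h0
      (fun k ↦ differentiableAt_covDir h0 (hd Y hY) (hS.smooth Z hZ) k) (hd W hW),
      cpderiv_eq_zero i (hS.pair_covDir_eq_zero hLC hY hZ hW), mul_zero]
  -- `[X, Y]` lies in the fibre at `y`
  have third : pair (fun a b ↦ q a b y)
      (fun k ↦ covDir Γ (coordBracket X Y) Z k y) (fun a ↦ W a y) = 0 := by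
    obtain ⟨B, hB, hBu⟩ := hS.maximal (fun a ↦ coordBracket X Y a y) fun A hA ↦
      (hS.bracket X hX Y hY A hA).self_of_nhds
    have := (hS.pair_covDir_eq_zero hLC hB hZ hW).self_of_nhds
    simpa only [covDir, hBu] using this
  simp only [sum_curvature_eq h0 (hd X hX) (hd Y hY) (hS.smooth Z hZ)]
  rw [pair_sub_left _ (fun k ↦ covDir Γ X (covDir Γ Y Z) k y - covDir Γ Y (covDir Γ X Z) k y),
    pair_sub_left, second X hX Y hY, second Y hY X hX, third]
  ring

/-! ### Symmetries of the curvature -/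

/-- The first Bianchi identity. -/
theorem curvature_bianchi (hLC : ∀ᶠ z in 𝓝 y, IsLeviCivitaAt q Γ z) (l i j k : Fin 4) :
    curvature Γ l i j k y + curvature Γ l j k i y + curvature Γ l k i j y = 0 := by
  have hd : ∀ i j k, cpderiv i (Γ l j k) y = cpderiv i (Γ l k j) y := fun i j k ↦
    cpderiv_congr i (hLC.mono fun z hz ↦ hz.torsion l j k)
  have ht : ∀ m i j, Γ m i j y = Γ m j i y := hLC.self_of_nhds.torsion
  simp only [curvature, Finset.sum_sub_distrib]
  simp only [hd j i k, hd i j k, hd k i j, ht _ j i, ht _ k i, ht _ k j]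
  ring

/-- The curvature operators are skew with respect to the metric: the second derivatives of
`q(A, B)` commute. -/
theorem pair_curvature_skew (hLC : ∀ᶠ z in 𝓝 y, IsLeviCivitaAt q Γ z)
    (hq : ∀ a b, ContDiffAt ℝ 2 (q a b) y) (u v : Fin 4 → ℂ) (i j : Fin 4) :
    pair (fun a b ↦ q a b y) (fun k ↦ ∑ m, curvature Γ k m i j y * u m) v +
      pair (fun a b ↦ q a b y) u (fun k ↦ ∑ m, curvature Γ k m i j y * v m) = 0 := by
  have h0 := hLC.self_of_nhds
  -- it suffices to differentiate fields with constant components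
  have hc : ∀ (w : Fin 4 → ℂ) (k : Fin 4), ContDiffAt ℝ 2 ((fun k (_ : E4) ↦ w k) k) y :=
    fun w k ↦ contDiffAt_const
  have hcd : ∀ (z : E4) (w : Fin 4 → ℂ) (k : Fin 4),
      DifferentiableAt ℝ ((fun k (_ : E4) ↦ w k) k) z := fun z w k ↦ differentiableAt_const _
  set U : Fin 4 → E4 → ℂ := fun k _ ↦ u k with hU
  set V : Fin 4 → E4 → ℂ := fun k _ ↦ v k with hV
  set f : E4 → ℂ := fun z ↦ pair (fun a b ↦ q a b z) (fun a ↦ U a z) (fun a ↦ V a z) with hf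
  have hfs : ContDiffAt ℝ 2 f y := by
    simp only [hf, pair]
    exact ContDiffAt.sum fun a _ ↦ ContDiffAt.sum fun b _ ↦
      ((hq a b).mul (hc u a)).mul (hc v b)
  have step : ∀ i j, cpderiv i (cpderiv j f) y =
      pair (fun a b ↦ q a b y) (fun a ↦ covDeriv Γ i (covDeriv Γ j U) a y) (fun a ↦ V a y) +
      pair (fun a b ↦ q a b y) (fun a ↦ covDeriv Γ j U a y) (fun a ↦ covDeriv Γ i V a y) +
      (pair (fun a b ↦ q a b y) (fun a ↦ covDeriv Γ i U a y) (fun a ↦ covDeriv Γ j V a y) +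
      pair (fun a b ↦ q a b y) (fun a ↦ U a y) (fun a ↦ covDeriv Γ i (covDeriv Γ j V) a y)) := by
    intro i j
    have e : cpderiv j f =ᶠ[𝓝 y] fun z ↦
        pair (fun a b ↦ q a b z) (fun a ↦ covDeriv Γ j U a z) (fun a ↦ V a z) +
        pair (fun a b ↦ q a b z) (fun a ↦ U a z) (fun a ↦ covDeriv Γ j V a z) :=
      hLC.mono fun z hz ↦ cpderiv_pair hz (hcd z u) (hcd z v) j
    have hdu := differentiableAt_covDeriv h0 (hc u) j
    have hdv := differentiableAt_covDeriv h0 (hc v) j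
    have hpair : ∀ {A B : Fin 4 → E4 → ℂ}, (∀ k, DifferentiableAt ℝ (A k) y) →
        (∀ k, DifferentiableAt ℝ (B k) y) → DifferentiableAt ℝ
        (fun z ↦ pair (fun a b ↦ q a b z) (fun a ↦ A a z) (fun a ↦ B a z)) y := by
      intro A B hA hB
      simp only [pair]
      exact DifferentiableAt.fun_sum fun a _ ↦ DifferentiableAt.fun_sum fun b _ ↦
        ((h0.diff_metric a b).fun_mul (hA a)).fun_mul (hB b)
    rw [cpderiv_congr i e, cpderiv_add i (hpair hdu (hcd y v)) (hpair (hcd y u) hdv),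
      cpderiv_pair h0 hdu (hcd y v), cpderiv_pair h0 (hcd y u) hdv]
  have hcomm := cpderiv_comm i j hfs
  rw [step, step] at hcomm
  have hr : ∀ (w : Fin 4 → ℂ), (fun k ↦ ∑ m, curvature Γ k m i j y * w m) = fun k ↦
      covDeriv Γ i (covDeriv Γ j fun k _ ↦ w k) k y -
      covDeriv Γ j (covDeriv Γ i fun k _ ↦ w k) k y := fun w ↦
    funext fun k ↦ (covDeriv_covDeriv_sub h0 (hc w) i j k).symm
  rw [hr, hr, pair_sub_left, pair_comm h0.symm u, pair_sub_left,
    pair_comm h0.symm _ u, pair_comm h0.symm _ u]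
  linear_combination hcomm

end LeviCivita

/-! ### The Levi-Civita connection of a metric given in coordinates -/

theorem contDiffAt_matrix_det {n : WithTop ℕ∞} {N : ℕ} {A : E4 → Matrix (Fin N) (Fin N) ℝ} {y : E4}
    (hA : ∀ a b, ContDiffAt ℝ n (fun z ↦ A z a b) y) :
    ContDiffAt ℝ n (fun z ↦ (A z).det) y := by
  simp only [Matrix.det_apply]
  exact ContDiffAt.sum fun σ _ ↦ (contDiffAt_prod fun i _ ↦ hA _ _).const_smul _

theorem contDiffAt_matrix_inv {n : WithTop ℕ∞} {N : ℕ} {A : E4 → Matrix (Fin N) (Fin N) ℝ} {y : E4}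
    (hA : ∀ a b, ContDiffAt ℝ n (fun z ↦ A z a b) y) (hdet : (A y).det ≠ 0) (i j : Fin N) :
    ContDiffAt ℝ n (fun z ↦ (A z)⁻¹ i j) y := by
  have e : (fun z ↦ (A z)⁻¹ i j) =
      fun z ↦ (A z).det⁻¹ * ((A z).updateRow j (Pi.single i 1)).det := by
    funext z
    rw [Matrix.inv_def, Matrix.smul_apply, Matrix.adjugate_apply, Ring.inverse_eq_inv', smul_eq_mul]
  rw [e]
  refine ((contDiffAt_matrix_det hA).inv hdet).mul (contDiffAt_matrix_det fun a b ↦ ?_)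
  by_cases h : a = j
  · subst h
    simpa using contDiffAt_const
  · simpa [Matrix.updateRow_ne h] using hA a b

/-- `G` is a twice continuously differentiable pseudo-Riemannian metric near `y`. -/
structure IsMetricAt (G : E4 → Matrix (Fin 4) (Fin 4) ℝ) (y : E4) : Prop where
  smooth : ∀ a b, ContDiffAt ℝ 2 (fun z ↦ G z a b) y
  symm : ∀ᶠ z in 𝓝 y, ∀ a b, G z a b = G z b a
  det_ne_zero : (G y).det ≠ 0

section Metric

variable {G : E4 → Matrix (Fin 4) (Fin 4) ℝ} {y : E4}

theorem IsMetricAt.eventually (h : IsMetricAt G y) : ∀ᶠ z in 𝓝 y, IsMetricAt G z := by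
  have hdet := (contDiffAt_matrix_det h.smooth).continuousAt.eventually_ne h.det_ne_zero
  have hs : ∀ᶠ z in 𝓝 y, ∀ a b, ContDiffAt ℝ 2 (fun z ↦ G z a b) z :=
    Filter.eventually_all.2 fun a ↦ Filter.eventually_all.2 fun b ↦ (h.smooth a b).eventually
      (by simp)
  filter_upwards [hdet, hs, h.symm.eventually_nhds] with z h1 h2 h3 using ⟨h2, h3, h1⟩

theorem IsMetricAt.pderiv_symm (h : IsMetricAt G y) (i a b : Fin 4) :
    pderiv i (fun z ↦ G z a b) y = pderiv i (fun z ↦ G z b a) y := by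
  have e : (fun z ↦ G z a b) =ᶠ[𝓝 y] fun z ↦ G z b a := h.symm.mono fun z hz ↦ hz a b
  rw [pderiv, pderiv, e.fderiv_eq]

theorem IsMetricAt.mul_inv (h : IsMetricAt G y) : G y * (G y)⁻¹ = 1 :=
  Matrix.mul_nonsing_inv _ (isUnit_iff_ne_zero.2 h.det_ne_zero)

theorem IsMetricAt.lower_christoffel (h : IsMetricAt G y) (b i a : Fin 4) :
    ∑ l, G y b l * christoffel G l i a y = (1 / 2) * (pderiv i (fun z ↦ G z a b) y +
      pderiv a (fun z ↦ G z i b) y - pderiv b (fun z ↦ G z i a) y) := by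
  have hi : ∀ m, ∑ l, G y b l * (G y)⁻¹ l m = if b = m then 1 else 0 := fun m ↦ by
    rw [← Matrix.mul_apply, h.mul_inv, Matrix.one_apply]
  calc ∑ l, G y b l * christoffel G l i a y
      = (1 / 2) * ∑ m, (∑ l, G y b l * (G y)⁻¹ l m) * (pderiv i (fun z ↦ G z a m) y +
          pderiv a (fun z ↦ G z i m) y - pderiv m (fun z ↦ G z i a) y) := by
        simp only [christoffel, Finset.sum_mul, Finset.mul_sum]
        rw [Finset.sum_comm]
        exact Finset.sum_congr rfl fun m _ ↦ Finset.sum_congr rfl fun l _ ↦ by ring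
    _ = _ := by simp [hi]

theorem IsMetricAt.differentiableAt_christoffel (h : IsMetricAt G y) (k i j : Fin 4) :
    DifferentiableAt ℝ (christoffel G k i j) y := by
  have hd : ∀ i a b, DifferentiableAt ℝ (pderiv i fun z ↦ G z a b) y := by
    intro i a b
    have h1 : ContDiffAt ℝ 1 (fderiv ℝ fun z ↦ G z a b) y :=
      (h.smooth a b).fderiv_right (by norm_num)
    exact (h1.differentiableAt (by norm_num)).clm_apply (differentiableAt_const _)
  unfold christoffel
  refine (DifferentiableAt.fun_sum fun l _ ↦ ?_).const_mul _
  exact ((contDiffAt_matrix_inv h.smooth h.det_ne_zero k l).differentiableAt (by norm_num)).mul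
    (((hd _ _ _).add (hd _ _ _)).sub (hd _ _ _))

/-- The Christoffel symbols define the Levi-Civita connection. -/
theorem IsMetricAt.isLeviCivitaAt (h : IsMetricAt G y) :
    IsLeviCivitaAt (fun a b z ↦ (G z a b : ℂ)) (fun k i j z ↦ (christoffel G k i j z : ℂ)) y where
  symm a b := by rw [h.symm.self_of_nhds]
  torsion k i j := by
    simp only [christoffel, h.pderiv_symm _ i j]
    norm_cast
    congr 1
    exact Finset.sum_congr rfl fun l _ ↦ by ring
  compat i a b := by
    rw [cpderiv_ofReal _ ((h.smooth a b).differentiableAt (by norm_num))]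
    norm_cast
    have h1 := h.lower_christoffel b i a
    have h2 := h.lower_christoffel a i b
    have hs := h.symm.self_of_nhds
    rw [Finset.sum_add_distrib, h2]
    simp only [hs _ b, h1]
    rw [h.pderiv_symm i b a]
    ring_nf
  diff_metric a b :=
    Complex.ofRealCLM.differentiableAt.comp y ((h.smooth a b).differentiableAt (by norm_num))
  diff_symbol k i j :=
    Complex.ofRealCLM.differentiableAt.comp y (h.differentiableAt_christoffel k i j)

theorem IsMetricAt.curvature_eq (h : IsMetricAt G y) (l k i j : Fin 4) :
    curvature (fun k i j z ↦ (christoffel G k i j z : ℂ)) l k i j y =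
      (riemannUp G l k i j y : ℂ) := by
  simp only [curvature, riemannUp]
  rw [cpderiv_ofReal _ (h.differentiableAt_christoffel _ _ _),
    cpderiv_ofReal _ (h.differentiableAt_christoffel _ _ _)]
  push_cast
  rfl

theorem riemann_swap_right (a b c d : Fin 4) : riemann G a b c d y = -riemann G a b d c y := by
  simp only [riemann, ← Finset.sum_neg_distrib]
  refine Finset.sum_congr rfl fun m _ ↦ ?_
  simp only [riemannUp, Finset.sum_sub_distrib]
  ring

theorem IsMetricAt.riemann_bianchi (h : IsMetricAt G y) (a b c d : Fin 4) :
    riemann G a b c d y + riemann G a c d b y + riemann G a d b c y = 0 := by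
  simp only [riemann, ← Finset.sum_add_distrib, ← mul_add]
  refine Finset.sum_eq_zero fun m _ ↦ ?_
  have := curvature_bianchi (h.eventually.mono fun z hz ↦ hz.isLeviCivitaAt) m b c d
  simp only [h.curvature_eq] at this
  norm_cast at this
  rw [this, mul_zero]

theorem IsMetricAt.riemann_swap_left (h : IsMetricAt G y) (a b c d : Fin 4) :
    riemann G a b c d y = -riemann G b a c d y := by
  have := pair_curvature_skew (h.eventually.mono fun z hz ↦ hz.isLeviCivitaAt)
    (fun a b ↦ Complex.ofRealCLM.contDiff.contDiffAt.comp y (h.smooth a b))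
    (Pi.single b 1) (Pi.single a 1) c d
  simp only [h.curvature_eq] at this
  simp only [pair, Pi.single_apply, mul_ite, mul_one, mul_zero, ite_mul, zero_mul,
    Finset.sum_ite_eq', Finset.mem_univ, if_true] at this
  simp only [Finset.sum_ite_irrel, Finset.sum_const_zero, Finset.sum_ite_eq',
    Finset.mem_univ, if_true] at this
  norm_cast at this
  simp only [h.symm.self_of_nhds _ a] at this
  exact eq_neg_of_add_eq_zero_left this

/-! ### Algebraic properties of the Weyl tensor -/

/-- `C` has the algebraic symmetries of a Weyl tensor with respect to the inverse metric `h`. -/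
structure IsWeylTensor {𝕜 : Type*} [Field 𝕜] (h : Matrix (Fin 4) (Fin 4) 𝕜)
    (C : Fin 4 → Fin 4 → Fin 4 → Fin 4 → 𝕜) : Prop where
  swap_left : ∀ a b c d, C a b c d = -C b a c d
  swap_right : ∀ a b c d, C a b c d = -C a b d c
  pair_symm : ∀ a b c d, C a b c d = C c d a b
  bianchi : ∀ a b c d, C a b c d + C a c d b + C a d b c = 0
  trace : ∀ b d, ∑ a, ∑ c, h a c * C a b c d = 0

/-- The pair symmetry follows from the two skew symmetries and the Bianchi identity. -/
theorem IsMetricAt.riemann_pair_symm (h : IsMetricAt G y) (a b c d : Fin 4) :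
    riemann G a b c d y = riemann G c d a b y := by
  have hl := h.riemann_swap_left
  have hr := fun a b c d ↦ riemann_swap_right (G := G) (y := y) a b c d
  have hb := h.riemann_bianchi
  linarith [hb a b c d, hb b c d a, hb c d a b, hb d a b c, hl a b c d, hl c d a b, hl a c d b,
    hl a d b c, hl b c d a, hl b d a c, hl b a c d, hl c a b d, hl c b d a, hl d a b c, hl d b c a,
    hl d c a b, hr a b c d, hr c d a b, hr a c d b, hr a d b c, hr b c d a, hr b d a c, hr b a c d,
    hr c a b d, hr c b d a, hr d a b c, hr d b c a, hr d c a b]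

theorem IsMetricAt.inv_symm (h : IsMetricAt G y) (a b : Fin 4) : (G y)⁻¹ a b = (G y)⁻¹ b a := by
  have hs : (G y).IsSymm := Matrix.IsSymm.ext fun a b ↦ h.symm.self_of_nhds b a
  have : ((G y)⁻¹).IsSymm := by
    rw [Matrix.IsSymm, Matrix.transpose_nonsing_inv, hs.eq]
  exact this.apply b a

theorem IsMetricAt.sum_inv_mul (h : IsMetricAt G y) (a b : Fin 4) :
    ∑ c, (G y)⁻¹ a c * G y c b = if a = b then 1 else 0 := by
  rw [← Matrix.mul_apply, Matrix.nonsing_inv_mul _ (isUnit_iff_ne_zero.2 h.det_ne_zero),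
    Matrix.one_apply]

theorem IsMetricAt.sum_inv_riemann (h : IsMetricAt G y) (m b c d : Fin 4) :
    ∑ a, (G y)⁻¹ m a * riemann G a b c d y = riemannUp G m b c d y := by
  simp only [riemann, Finset.mul_sum, ← mul_assoc]
  rw [Finset.sum_comm]
  simp only [← Finset.sum_mul, h.sum_inv_mul]
  simp

theorem IsMetricAt.ricci_eq (h : IsMetricAt G y) (b d : Fin 4) :
    ricci G b d y = ∑ a, ∑ c, (G y)⁻¹ a c * riemann G a b c d y := by
  rw [Finset.sum_comm]
  simp only [ricci, ← h.sum_inv_riemann]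
  exact Finset.sum_congr rfl fun m _ ↦ Finset.sum_congr rfl fun a _ ↦ by rw [h.inv_symm]

theorem IsMetricAt.ricci_symm (h : IsMetricAt G y) (b d : Fin 4) :
    ricci G b d y = ricci G d b y := by
  rw [h.ricci_eq, h.ricci_eq, Finset.sum_comm]
  refine Finset.sum_congr rfl fun a _ ↦ Finset.sum_congr rfl fun c _ ↦ ?_
  rw [h.inv_symm, h.riemann_pair_symm]

theorem IsMetricAt.isWeylTensor (h : IsMetricAt G y) :
    IsWeylTensor (G y)⁻¹ (fun a b c d ↦ weylCoord G a b c d y) where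
  swap_left a b c d := by
    simp only [weylCoord, h.riemann_swap_left a b]
    ring
  swap_right a b c d := by
    simp only [weylCoord, riemann_swap_right a b c d]
    ring
  pair_symm a b c d := by
    have hs := h.symm.self_of_nhds
    simp only [weylCoord, h.riemann_pair_symm a b, h.ricci_symm c, h.ricci_symm d, hs c, hs d]
    ring
  bianchi a b c d := by
    have hs := h.symm.self_of_nhds
    simp only [weylCoord]
    rw [hs c b, hs d b, hs d c, h.ricci_symm c b, h.ricci_symm d b, h.ricci_symm d c]
    linear_combination h.riemann_bianchi a b c d
  trace b d := by
    have hs := h.symm.self_of_nhds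
    have e1 : ∑ a, ∑ c, (G y)⁻¹ a c * G y a c = 4 := by
      have : ∀ a, ∑ c, (G y)⁻¹ a c * G y c a = 1 := fun a ↦ by simp [h.sum_inv_mul]
      have e : ∀ a, ∑ c, (G y)⁻¹ a c * G y a c = 1 := fun a ↦ by simpa only [hs a] using this a
      simp [e]
    have e2 : ∀ f : Fin 4 → ℝ, ∑ a, ∑ c, (G y)⁻¹ a c * (G y a d * f c) = f d := by
      intro f
      rw [Finset.sum_comm]
      have : ∀ c, ∑ a, (G y)⁻¹ a c * (G y a d * f c) = (if c = d then 1 else 0) * f c := by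
        intro c
        rw [← h.sum_inv_mul, Finset.sum_mul]
        exact Finset.sum_congr rfl fun a _ ↦ by rw [h.inv_symm]; ring
      simp [this]
    have e3 : ∀ f : Fin 4 → ℝ, ∑ a, ∑ c, (G y)⁻¹ a c * (G y b c * f a) = f b := by
      intro f
      have : ∀ a, ∑ c, (G y)⁻¹ a c * (G y b c * f a) = (if a = b then 1 else 0) * f a := by
        intro a
        rw [← h.sum_inv_mul, Finset.sum_mul]
        exact Finset.sum_congr rfl fun c _ ↦ by rw [hs b]; ring
      simp [this]
    have e4 : ∑ a, ∑ c, (G y)⁻¹ a c * weylCoord G a b c d y =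
        ∑ a, ∑ c, (G y)⁻¹ a c * riemann G a b c d y -
        (1 / 2) * ((∑ a, ∑ c, (G y)⁻¹ a c * G y a c) * ricci G b d y
          - ∑ a, ∑ c, (G y)⁻¹ a c * (G y a d * ricci G b c y)
          - ∑ a, ∑ c, (G y)⁻¹ a c * (G y b c * ricci G a d y)
          + G y b d * ∑ a, ∑ c, (G y)⁻¹ a c * ricci G a c y) +
        (scalarCurvature G y / 6) * ((∑ a, ∑ c, (G y)⁻¹ a c * G y a c) * G y b d
          - ∑ a, ∑ c, (G y)⁻¹ a c * (G y a d * G y b c)) := by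
      simp only [weylCoord, Finset.mul_sum, Finset.sum_mul, ← Finset.sum_sub_distrib,
        ← Finset.sum_add_distrib]
      exact Finset.sum_congr rfl fun a _ ↦ Finset.sum_congr rfl fun c _ ↦ by ring
    rw [e4, e1, e2, e2, e3, ← h.ricci_eq, ← scalarCurvature]
    ring

/-- On a totally null plane the Weyl tensor and the Riemann tensor agree. -/
theorem sum_weylCoord_eq_sum_riemann (X Y : Fin 4 → ℂ)
    (hXX : pair (fun a b ↦ (G y a b : ℂ)) X X = 0) (hXY : pair (fun a b ↦ (G y a b : ℂ)) X Y = 0)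
    (hYX : pair (fun a b ↦ (G y a b : ℂ)) Y X = 0) (hYY : pair (fun a b ↦ (G y a b : ℂ)) Y Y = 0) :
    ∑ a, ∑ b, ∑ c, ∑ d, (weylCoord G a b c d y : ℂ) * X a * Y b * X c * Y d =
      ∑ a, ∑ b, ∑ c, ∑ d, (riemann G a b c d y : ℂ) * X a * Y b * X c * Y d := by
  have prod : ∀ (f h : Fin 4 → Fin 4 → ℂ) (U V W Z : Fin 4 → ℂ),
      ∑ a, ∑ b, ∑ c, ∑ d, f a b * U a * V b * (h c d * W c * Z d) = pair f U V * pair h W Z := by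
    intro f h U V W Z
    simp only [pair, Finset.sum_mul]
    simp only [Finset.mul_sum]
  set g : Fin 4 → Fin 4 → ℂ := fun a b ↦ (G y a b : ℂ) with hg
  set r : Fin 4 → Fin 4 → ℂ := fun a b ↦ (ricci G a b y : ℂ) with hr
  -- the four index patterns occurring in the products of the metric with a second tensor
  have p1 : ∀ f h : Fin 4 → Fin 4 → ℂ,
      ∑ a, ∑ b, ∑ c, ∑ d, f a c * h b d * X a * Y b * X c * Y d = pair f X X * pair h Y Y := by
    intro f h
    rw [← prod]
    refine Finset.sum_congr rfl fun a _ ↦ ?_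
    rw [Finset.sum_comm]
    refine Finset.sum_congr rfl fun b _ ↦ Finset.sum_congr rfl fun c _ ↦
      Finset.sum_congr rfl fun d _ ↦ by ring
  have p2 : ∀ f h : Fin 4 → Fin 4 → ℂ,
      ∑ a, ∑ b, ∑ c, ∑ d, f a d * h b c * X a * Y b * X c * Y d = pair f X Y * pair h Y X := by
    intro f h
    rw [← prod]
    refine Finset.sum_congr rfl fun a _ ↦ ?_
    have : ∀ b, ∑ c, ∑ d, f a d * h b c * X a * Y b * X c * Y d =
        ∑ d, ∑ c, f a d * h b c * X a * Y b * X c * Y d := fun b ↦ Finset.sum_comm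
    simp only [this]
    rw [Finset.sum_comm]
    refine Finset.sum_congr rfl fun b _ ↦ Finset.sum_congr rfl fun c _ ↦
      Finset.sum_congr rfl fun d _ ↦ by ring
  have e : ∑ a, ∑ b, ∑ c, ∑ d, (weylCoord G a b c d y : ℂ) * X a * Y b * X c * Y d =
      ∑ a, ∑ b, ∑ c, ∑ d, (riemann G a b c d y : ℂ) * X a * Y b * X c * Y d -
      (1 / 2) * (∑ a, ∑ b, ∑ c, ∑ d, g a c * r b d * X a * Y b * X c * Y d -
        ∑ a, ∑ b, ∑ c, ∑ d, g a d * r b c * X a * Y b * X c * Y d -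
        ∑ a, ∑ b, ∑ c, ∑ d, r a d * g b c * X a * Y b * X c * Y d +
        ∑ a, ∑ b, ∑ c, ∑ d, r a c * g b d * X a * Y b * X c * Y d) +
      ((scalarCurvature G y : ℂ) / 6) *
        (∑ a, ∑ b, ∑ c, ∑ d, g a c * g b d * X a * Y b * X c * Y d -
        ∑ a, ∑ b, ∑ c, ∑ d, g a d * g b c * X a * Y b * X c * Y d) := by
    simp only [weylCoord, Finset.mul_sum, ← Finset.sum_sub_distrib, ← Finset.sum_add_distrib,
      hg, hr]
    refine Finset.sum_congr rfl fun a _ ↦ Finset.sum_congr rfl fun b _ ↦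
      Finset.sum_congr rfl fun c _ ↦ Finset.sum_congr rfl fun d _ ↦ ?_
    push_cast
    ring
  rw [e, p1, p1, p1, p2, p2, p2, hXX, hXY, hYX, hYY]
  ring

end Metric

/-! ### Complex null frames -/

/-- The Gram matrix of a null frame `(l, n, m, m')`: `g(l, n) = g(m, m') = 1` and all other products
of frame vectors vanish. -/
def nullGram : Matrix (Fin 4) (Fin 4) ℂ :=
  !![0, 1, 0, 0; 1, 0, 0, 0; 0, 0, 0, 1; 0, 0, 1, 0]

theorem nullGram_mul_self : nullGram * nullGram = 1 := by
  ext i j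
  fin_cases i <;> fin_cases j <;> simp [nullGram, Matrix.mul_apply, Fin.sum_univ_four]

theorem det_nullGram : nullGram.det = 1 := by
  simp [nullGram, Matrix.det_succ_row_zero, Fin.sum_univ_succ, Fin.succAbove]

theorem transpose_nullGram : nullGram.transpose = nullGram := by
  ext i j
  fin_cases i <;> fin_cases j <;> simp [nullGram]

/-- A nondegenerate real symmetric form has a complex null frame, the columns of `P`. -/
theorem exists_nullFrame {A : Matrix (Fin 4) (Fin 4) ℝ} (hA : A.IsSymm) (hdet : A.det ≠ 0) :
    ∃ P : Matrix (Fin 4) (Fin 4) ℂ,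
      P.transpose * A.map Complex.ofReal * P = nullGram := by
  have hH : A.IsHermitian := by
    rw [Matrix.IsHermitian, Matrix.conjTranspose_eq_transpose_of_trivial]; exact hA
  have hne : ∀ i, hH.eigenvalues i ≠ 0 := by
    intro i h0
    apply hdet
    rw [hH.det_eq_prod_eigenvalues]
    exact Finset.prod_eq_zero (Finset.mem_univ i) (by simp [h0])
  -- over `ℂ` the eigenvalues can be normalized to `1`, whatever the signature
  have hc : ∀ i, ∃ c : ℂ, c * hH.eigenvalues i * c = 1 := by
    intro i
    obtain ⟨c, hc⟩ := IsAlgClosed.exists_pow_nat_eq ((hH.eigenvalues i : ℂ)⁻¹) (n := 2)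
      (by norm_num)
    refine ⟨c, ?_⟩
    have : (hH.eigenvalues i : ℂ) ≠ 0 := by exact_mod_cast hne i
    calc c * hH.eigenvalues i * c = c ^ 2 * hH.eigenvalues i := by ring
      _ = 1 := by rw [hc, inv_mul_cancel₀ this]
  choose c hc using hc
  set U : Matrix (Fin 4) (Fin 4) ℝ := (hH.eigenvectorUnitary : Matrix (Fin 4) (Fin 4) ℝ) with hU
  have hUU : U.transpose * U = 1 := by
    have := Matrix.mem_unitaryGroup_iff'.1 hH.eigenvectorUnitary.2
    rwa [Matrix.star_eq_conjTranspose, Matrix.conjTranspose_eq_transpose_of_trivial] at this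
  have hsp : U.transpose * A * U = Matrix.diagonal hH.eigenvalues := by
    have := hH.spectral_theorem
    rw [Unitary.conjStarAlgAut_apply] at this
    rw [Matrix.star_eq_conjTranspose,
      Matrix.conjTranspose_eq_transpose_of_trivial, ← hU] at this
    conv_lhs => rw [this]
    calc _ = (U.transpose * U) * Matrix.diagonal (RCLike.ofReal ∘ hH.eigenvalues) *
          (U.transpose * U) := by simp only [Matrix.mul_assoc]
      _ = _ := by rw [hUU]; simp
  set V : Matrix (Fin 4) (Fin 4) ℂ := U.map Complex.ofReal with hV
  have hspC : V.transpose * A.map Complex.ofReal * V =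
      Matrix.diagonal fun i ↦ (hH.eigenvalues i : ℂ) := by
    have := congrArg (fun B : Matrix (Fin 4) (Fin 4) ℝ ↦ B.map Complex.ofRealHom) hsp
    simp only [Matrix.map_mul] at this
    rw [Matrix.diagonal_map (by simp)] at this
    exact this
  -- `e₀ ± i e₁` and `e₂ ± i e₃`, up to scale, for an orthonormal basis `e₀, e₁, e₂, e₃`
  let N : Matrix (Fin 4) (Fin 4) ℂ := !![1/2, 1, 0, 0; Complex.I/2, -Complex.I, 0, 0;
    0, 0, 1/2, 1; 0, 0, Complex.I/2, -Complex.I]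
  have hN : N.transpose * N = nullGram := by
    ext i j
    fin_cases i <;> fin_cases j <;>
      simp [N, nullGram, Matrix.mul_apply, Fin.sum_univ_four] <;> ring_nf <;> norm_num
  refine ⟨V * Matrix.diagonal c * N, ?_⟩
  calc _ = N.transpose * ((Matrix.diagonal c).transpose *
        (V.transpose * A.map Complex.ofReal * V) * Matrix.diagonal c) * N := by
        simp only [Matrix.transpose_mul, Matrix.mul_assoc]
    _ = _ := by
        rw [hspC, Matrix.diagonal_transpose, Matrix.diagonal_mul_diagonal,
          Matrix.diagonal_mul_diagonal]
        simp only [hc, Matrix.diagonal_one, Matrix.mul_one, hN]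

/-! ### The Levi-Civita symbol -/

/-- The Levi-Civita symbol. -/
def leviCivita (a b c d : Fin 4) : ℂ :=
  ((1 : Matrix (Fin 4) (Fin 4) ℂ).submatrix id ![a, b, c, d]).det

/-- The Levi-Civita symbol as a product of differences, a Vandermonde determinant. -/
theorem leviCivita_eq (a b c d : Fin 4) : leviCivita a b c d =
    (((b : ℕ) : ℂ) - (a : ℕ)) * ((c : ℕ) - (a : ℕ)) * ((d : ℕ) - (a : ℕ)) *
      ((c : ℕ) - (b : ℕ)) * ((d : ℕ) - (b : ℕ)) * ((d : ℕ) - (c : ℕ)) / 12 := by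
  have e : Matrix.vandermonde (fun i ↦ (((![a, b, c, d] i : Fin 4) : ℕ) : ℂ)) =
      ((1 : Matrix (Fin 4) (Fin 4) ℂ).submatrix id ![a, b, c, d]).transpose *
        Matrix.vandermonde fun i : Fin 4 ↦ ((i : ℕ) : ℂ) := by
    ext i j
    rw [Matrix.mul_apply]
    simp only [Matrix.vandermonde_apply, Matrix.transpose_apply, Matrix.submatrix_apply, id_eq,
      Matrix.one_apply, ite_mul, one_mul, zero_mul]
    rw [Finset.sum_ite_eq' Finset.univ (![a, b, c, d] i) fun k : Fin 4 ↦ ((k : ℕ) : ℂ) ^ (j : ℕ)]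
    simp
  have h := congrArg Matrix.det e
  rw [Matrix.det_mul, Matrix.det_transpose, ← leviCivita, Matrix.det_vandermonde,
    Matrix.det_vandermonde] at h
  have hI : ∀ f : Fin 4 → ℂ, ∏ i : Fin 4, ∏ j ∈ Finset.Ioi i, (f j - f i) =
      (f 1 - f 0) * (f 2 - f 0) * (f 3 - f 0) * (f 2 - f 1) * (f 3 - f 1) * (f 3 - f 2) := by
    intro f
    have h0 : Finset.Ioi (0 : Fin 4) = {1, 2, 3} := by decide
    have h1 : Finset.Ioi (1 : Fin 4) = {2, 3} := by decide
    have h2 : Finset.Ioi (2 : Fin 4) = {3} := by decide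
    have h3 : Finset.Ioi (3 : Fin 4) = ∅ := by decide
    rw [Fin.prod_univ_four, h0, h1, h2, h3]
    rw [Finset.prod_insert (by decide), Finset.prod_insert (by decide), Finset.prod_singleton,
      Finset.prod_insert (by decide), Finset.prod_singleton, Finset.prod_singleton,
      Finset.prod_empty]
    ring
  rw [hI, hI] at h
  simp at h
  rw [eq_div_iff (by norm_num)]
  norm_num at h
  linear_combination -h

theorem sum_fin_succ_fun {n : ℕ} (f : (Fin (n + 1) → Fin 4) → ℂ) :
    ∑ r, f r = ∑ a, ∑ r : Fin n → Fin 4, f (Matrix.vecCons a r) := by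
  rw [← (Fin.consEquiv fun _ : Fin (n + 1) ↦ Fin 4).sum_comp f, Fintype.sum_prod_type]
  rfl

/-- The determinant expanded in its four columns. -/
theorem det_eq_sum_leviCivita (M : Matrix (Fin 4) (Fin 4) ℂ) :
    M.det = ∑ a, ∑ b, ∑ c, ∑ d, leviCivita a b c d * (M a 0 * M b 1 * M c 2 * M d 3) := by
  have e : M.transpose = fun i ↦ ∑ j, M j i • (Pi.single j (1 : ℂ) : Fin 4 → ℂ) := by
    funext i
    simpa using (pi_eq_sum_univ' (M.transpose i))
  rw [← Matrix.det_transpose]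
  change Matrix.detRowAlternating M.transpose = _
  rw [e]
  change Matrix.detRowAlternating.toMultilinearMap _ = _
  rw [MultilinearMap.map_sum]
  simp only [MultilinearMap.map_smul_univ, sum_fin_succ_fun, Finset.univ_unique,
    Finset.sum_singleton]
  refine Finset.sum_congr rfl fun a _ ↦ Finset.sum_congr rfl fun b _ ↦
    Finset.sum_congr rfl fun c _ ↦ Finset.sum_congr rfl fun d _ ↦ ?_
  rw [smul_eq_mul, mul_comm]
  congr 1
  · rw [leviCivita, ← Matrix.det_transpose]
    change Matrix.det _ = _
    congr 1
    ext i j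
    fin_cases i <;> simp [Matrix.one_apply, Pi.single_apply] <;> rfl
  · simp [Fin.prod_univ_four]

theorem sum_leviCivita_mul (P : Matrix (Fin 4) (Fin 4) ℂ) (i j k l : Fin 4) :
    ∑ a, ∑ b, ∑ c, ∑ d, leviCivita a b c d * (P a i * P b j * P c k * P d l) =
      P.det * leviCivita i j k l := by
  have h := det_eq_sum_leviCivita (P.submatrix id ![i, j, k, l])
  have e : P.submatrix id ![i, j, k, l] =
      P * (1 : Matrix (Fin 4) (Fin 4) ℂ).submatrix id ![i, j, k, l] := by
    ext a b
    simp [Matrix.mul_apply, Matrix.one_apply]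
  rw [leviCivita, ← Matrix.det_mul, ← e, h]
  rfl

/-! ### The Hodge star in a null frame -/

/-- The contraction `½ ε_{abcd} U^{cd}`. -/
def epsContract (U : Matrix (Fin 4) (Fin 4) ℂ) : Matrix (Fin 4) (Fin 4) ℂ :=
  Matrix.of fun a b ↦ (1 / 2) * ∑ c, ∑ d, leviCivita a b c d * U c d

/-- The contraction with the Levi-Civita symbol scales by the determinant under a change of
frame. -/
theorem epsContract_frame (P U : Matrix (Fin 4) (Fin 4) ℂ) :
    P.transpose * epsContract (P * U * P.transpose) * P = P.det • epsContract U := by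
  ext i j
  have e1 : (P.transpose * epsContract (P * U * P.transpose) * P) i j = (1 / 2) *
      ∑ a, ∑ b, ∑ c, ∑ d, ∑ k, ∑ l,
        leviCivita a b c d * (P a i * P b j * P c k * P d l) * U k l := by
    simp only [Matrix.mul_apply, epsContract, Matrix.of_apply, Matrix.transpose_apply,
      Finset.sum_mul, Finset.mul_sum]
    rw [Finset.sum_comm]
    refine Finset.sum_congr rfl fun a _ ↦ Finset.sum_congr rfl fun b _ ↦
      Finset.sum_congr rfl fun c _ ↦ Finset.sum_congr rfl fun d _ ↦ ?_
    rw [Finset.sum_comm]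
    exact Finset.sum_congr rfl fun k _ ↦ Finset.sum_congr rfl fun l _ ↦ by ring
  have comm4 : ∀ F : Fin 4 → Fin 4 → Fin 4 → Fin 4 → Fin 4 → Fin 4 → ℂ,
      ∑ a, ∑ b, ∑ c, ∑ d, ∑ k, ∑ l, F a b c d k l =
        ∑ k, ∑ l, ∑ a, ∑ b, ∑ c, ∑ d, F a b c d k l := by
    intro F
    have swap : ∀ H : Fin 4 → Fin 4 × Fin 4 → ℂ, ∑ d, ∑ p, H d p = ∑ p, ∑ d, H d p :=
      fun H ↦ Finset.sum_comm
    have : ∑ a, ∑ b, ∑ c, ∑ d, ∑ p : Fin 4 × Fin 4, F a b c d p.1 p.2 =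
        ∑ p : Fin 4 × Fin 4, ∑ a, ∑ b, ∑ c, ∑ d, F a b c d p.1 p.2 := by
      simp only [swap]
    simpa only [Fintype.sum_prod_type] using this
  rw [e1, comm4]
  simp only [← Finset.sum_mul, sum_leviCivita_mul]
  simp only [Matrix.smul_apply, epsContract, Matrix.of_apply, smul_eq_mul, Finset.mul_sum]
  exact Finset.sum_congr rfl fun k _ ↦ Finset.sum_congr rfl fun l _ ↦ by ring

/-- The Hodge star on `2`-forms in a null frame `(l, n, m, m')` with `ε(l, n, m, m') = 1`; indices
are raised by `nullGram`, which is its own inverse. -/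
def nullHodge (W : Matrix (Fin 4) (Fin 4) ℂ) : Matrix (Fin 4) (Fin 4) ℂ :=
  epsContract (nullGram * W * nullGram)

theorem nullGram_conj (W : Matrix (Fin 4) (Fin 4) ℂ) (a b : Fin 4) :
    (nullGram * W * nullGram) a b =
      W ((![1, 0, 3, 2] : Fin 4 → Fin 4) a) ((![1, 0, 3, 2] : Fin 4 → Fin 4) b) := by
  have h1 : ∀ i j, nullGram i j = if (![1, 0, 3, 2] : Fin 4 → Fin 4) i = j then 1 else 0 := by
    intro i j
    fin_cases i <;> fin_cases j <;> simp [nullGram]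
  have h2 : ∀ i j, nullGram i j = if (![1, 0, 3, 2] : Fin 4 → Fin 4) j = i then 1 else 0 := by
    intro i j
    fin_cases i <;> fin_cases j <;> simp [nullGram]
  simp only [Matrix.mul_apply]
  conv_lhs => enter [2, x]; rw [h2 x b]
  simp [h1]

/-- The anti-self-dual `2`-forms in a null frame. -/
theorem nullHodge_eq_neg {W : Matrix (Fin 4) (Fin 4) ℂ} (hW : ∀ a b, W a b = -W b a)
    (h01 : W 0 1 = W 2 3) (h03 : W 0 3 = 0) (h12 : W 1 2 = 0) : nullHodge W = -W := by
  have hd : ∀ a, W a a = 0 := fun a ↦ by linear_combination (1 / 2 : ℂ) * hW a a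
  have h10 := hW 1 0
  have h20 := hW 2 0
  have h30 := hW 3 0
  have h21 := hW 2 1
  have h31 := hW 3 1
  have h32 := hW 3 2
  rw [h01] at h10
  rw [h03] at h30
  rw [h12] at h21
  ext i j
  fin_cases i <;> fin_cases j <;>
    simp [nullHodge, epsContract, nullGram_conj, leviCivita_eq, Fin.sum_univ_four, hd,
      h01, h03, h12, h10, h20, h30, h21, h31, h32] <;> ring

/-- The self-dual `2`-forms in a null frame. -/
theorem nullHodge_eq_self {W : Matrix (Fin 4) (Fin 4) ℂ} (hW : ∀ a b, W a b = -W b a)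
    (h01 : W 0 1 = -W 2 3) (h02 : W 0 2 = 0) (h13 : W 1 3 = 0) : nullHodge W = W := by
  have hd : ∀ a, W a a = 0 := fun a ↦ by linear_combination (1 / 2 : ℂ) * hW a a
  have h10 := hW 1 0
  have h20 := hW 2 0
  have h30 := hW 3 0
  have h21 := hW 2 1
  have h31 := hW 3 1
  have h32 := hW 3 2
  rw [h01] at h10
  rw [h02] at h20
  rw [h13] at h31
  ext i j
  fin_cases i <;> fin_cases j <;>
    simp [nullHodge, epsContract, nullGram_conj, leviCivita_eq, Fin.sum_univ_four, hd,
      h01, h02, h13, h10, h20, h30, h21, h31, h32] <;> ring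

/-! ### Weyl tensors in a null frame -/

/-- The quadrilinear form with coefficients `C`. -/
def quad (C : Fin 4 → Fin 4 → Fin 4 → Fin 4 → ℂ) (u v w z : Fin 4 → ℂ) : ℂ :=
  ∑ a, ∑ b, ∑ c, ∑ d, C a b c d * u a * v b * w c * z d

/-- The components of `C` in the frame formed by the columns of `P`. -/
def frameTensor (P : Matrix (Fin 4) (Fin 4) ℂ) (C : Fin 4 → Fin 4 → Fin 4 → Fin 4 → ℂ)
    (i j k l : Fin 4) : ℂ :=
  quad C (fun a ↦ P a i) (fun a ↦ P a j) (fun a ↦ P a k) (fun a ↦ P a l)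

section quad

variable {h : Matrix (Fin 4) (Fin 4) ℂ} {C : Fin 4 → Fin 4 → Fin 4 → Fin 4 → ℂ}

theorem IsWeylTensor.quad_swap_left (hC : IsWeylTensor h C) (u v w z : Fin 4 → ℂ) :
    quad C u v w z = -quad C v u w z := by
  simp only [quad, ← Finset.sum_neg_distrib]
  rw [Finset.sum_comm]
  refine Finset.sum_congr rfl fun a _ ↦ Finset.sum_congr rfl fun b _ ↦
    Finset.sum_congr rfl fun c _ ↦ Finset.sum_congr rfl fun d _ ↦ ?_
  rw [hC.swap_left]; ring

theorem IsWeylTensor.quad_swap_right (hC : IsWeylTensor h C) (u v w z : Fin 4 → ℂ) :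
    quad C u v w z = -quad C u v z w := by
  simp only [quad, ← Finset.sum_neg_distrib]
  refine Finset.sum_congr rfl fun a _ ↦ Finset.sum_congr rfl fun b _ ↦ ?_
  rw [Finset.sum_comm]
  refine Finset.sum_congr rfl fun c _ ↦ Finset.sum_congr rfl fun d _ ↦ ?_
  rw [hC.swap_right]; ring

theorem IsWeylTensor.quad_pair_symm (hC : IsWeylTensor h C) (u v w z : Fin 4 → ℂ) :
    quad C u v w z = quad C w z u v := by
  have e : ∀ F : Fin 4 × Fin 4 → Fin 4 × Fin 4 → ℂ,
      ∑ a, ∑ b, ∑ c, ∑ d, F (a, b) (c, d) = ∑ c, ∑ d, ∑ a, ∑ b, F (a, b) (c, d) := by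
    intro F
    have : ∑ p, ∑ q, F p q = ∑ q, ∑ p, F p q := Finset.sum_comm
    simpa only [Fintype.sum_prod_type] using this
  simp only [quad]
  rw [e fun p q ↦ C p.1 p.2 q.1 q.2 * u p.1 * v p.2 * w q.1 * z q.2]
  refine Finset.sum_congr rfl fun a _ ↦ Finset.sum_congr rfl fun b _ ↦
    Finset.sum_congr rfl fun c _ ↦ Finset.sum_congr rfl fun d _ ↦ ?_
  rw [hC.pair_symm]; ring

theorem IsWeylTensor.quad_bianchi (hC : IsWeylTensor h C) (u v w z : Fin 4 → ℂ) :
    quad C u v w z + quad C u w z v + quad C u z v w = 0 := by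
  have rot : ∀ F : Fin 4 → Fin 4 → Fin 4 → ℂ,
      ∑ b, ∑ c, ∑ d, F b c d = ∑ b, ∑ c, ∑ d, F c d b := by
    intro F
    conv_rhs => rw [Finset.sum_comm]
    exact Finset.sum_congr rfl fun c _ ↦ Finset.sum_comm
  simp only [quad, ← Finset.sum_add_distrib]
  refine Finset.sum_eq_zero fun a _ ↦ ?_
  simp only [Finset.sum_add_distrib]
  rw [rot fun b c d ↦ C a b c d * u a * w b * z c * v d,
    rot fun b c d ↦ C a b c d * u a * z b * v c * w d,
    rot fun b c d ↦ C a c d b * u a * z c * v d * w b]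
  simp only [← Finset.sum_add_distrib]
  refine Finset.sum_eq_zero fun b _ ↦ Finset.sum_eq_zero fun c _ ↦ Finset.sum_eq_zero fun d _ ↦ ?_
  linear_combination u a * v b * w c * z d * hC.bianchi a b c d

theorem IsWeylTensor.frameTensor {P : Matrix (Fin 4) (Fin 4) ℂ} (hC : IsWeylTensor h C)
    (hP : P * nullGram * P.transpose = h) : IsWeylTensor nullGram (frameTensor P C) where
  swap_left _ _ _ _ := hC.quad_swap_left _ _ _ _
  swap_right _ _ _ _ := hC.quad_swap_right _ _ _ _
  pair_symm _ _ _ _ := hC.quad_pair_symm _ _ _ _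
  bianchi _ _ _ _ := hC.quad_bianchi _ _ _ _
  trace j l := by
    have hP' : ∀ a c, ∑ i, ∑ k, nullGram i k * (P a i * P c k) = h a c := by
      intro a c
      rw [← hP]
      simp only [Matrix.mul_apply, Matrix.transpose_apply, Finset.sum_mul]
      rw [Finset.sum_comm]
      exact Finset.sum_congr rfl fun k _ ↦ Finset.sum_congr rfl fun i _ ↦ by ring
    have swap : ∀ H : Fin 4 → Fin 4 × Fin 4 → ℂ, ∑ d, ∑ p, H d p = ∑ p, ∑ d, H d p :=
      fun H ↦ Finset.sum_comm
    have e : ∑ i, ∑ k, nullGram i k * ParaHermitian.frameTensor P C i j k l =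
        ∑ a, ∑ b, ∑ c, ∑ d, C a b c d * P b j * P d l *
          ∑ i, ∑ k, nullGram i k * (P a i * P c k) := by
      have : ∑ a, ∑ b, ∑ c, ∑ d, ∑ p : Fin 4 × Fin 4, C a b c d * P b j * P d l *
          (nullGram p.1 p.2 * (P a p.1 * P c p.2)) =
          ∑ p : Fin 4 × Fin 4, ∑ a, ∑ b, ∑ c, ∑ d, C a b c d * P b j * P d l *
          (nullGram p.1 p.2 * (P a p.1 * P c p.2)) := by
        simp only [swap]
      simp only [Fintype.sum_prod_type] at this
      simp only [ParaHermitian.frameTensor, quad, Finset.mul_sum]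
      rw [this]
      refine Finset.sum_congr rfl fun i _ ↦ Finset.sum_congr rfl fun k _ ↦
        Finset.sum_congr rfl fun a _ ↦ Finset.sum_congr rfl fun b _ ↦
        Finset.sum_congr rfl fun c _ ↦ Finset.sum_congr rfl fun d _ ↦ by ring
    rw [e]
    simp only [hP']
    have e2 : ∑ a, ∑ b, ∑ c, ∑ d, C a b c d * P b j * P d l * h a c =
        ∑ b, ∑ d, P b j * P d l * ∑ a, ∑ c, h a c * C a b c d := by
      simp only [Finset.mul_sum]
      rw [Finset.sum_comm]
      refine Finset.sum_congr rfl fun b _ ↦ ?_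
      have : ∀ a, ∑ c, ∑ d, C a b c d * P b j * P d l * h a c =
          ∑ d, ∑ c, C a b c d * P b j * P d l * h a c := fun a ↦ Finset.sum_comm
      simp only [this]
      rw [Finset.sum_comm]
      exact Finset.sum_congr rfl fun d _ ↦ Finset.sum_congr rfl fun a _ ↦
        Finset.sum_congr rfl fun c _ ↦ by ring
    rw [e2]
    simp [hC.trace]

theorem frameTensor_quad (P : Matrix (Fin 4) (Fin 4) ℂ) (u v w z : Fin 4 → ℂ) :
    quad (frameTensor P C) u v w z =
      quad C (P.mulVec u) (P.mulVec v) (P.mulVec w) (P.mulVec z) := by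
  have swap : ∀ H : Fin 4 → (Fin 4 × Fin 4) × Fin 4 × Fin 4 → ℂ,
    ∑ d, ∑ p, H d p = ∑ p, ∑ d, H d p := fun H ↦ Finset.sum_comm
  have this : (∑ i, ∑ j, ∑ k, ∑ l, ∑ p : (Fin 4 × Fin 4) × Fin 4 × Fin 4,
        C p.1.1 p.1.2 p.2.1 p.2.2 * (P p.1.1 i * u i) * (P p.1.2 j * v j) * (P p.2.1 k * w k) *
          (P p.2.2 l * z l)) =
      ∑ p : (Fin 4 × Fin 4) × Fin 4 × Fin 4, ∑ i, ∑ j, ∑ k, ∑ l,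
        C p.1.1 p.1.2 p.2.1 p.2.2 * (P p.1.1 i * u i) * (P p.1.2 j * v j) * (P p.2.1 k * w k) *
          (P p.2.2 l * z l) := by simp only [swap]
  simp only [Fintype.sum_prod_type] at this
  have hl : quad (frameTensor P C) u v w z = ∑ i, ∑ j, ∑ k, ∑ l, ∑ a, ∑ b, ∑ c, ∑ d,
      C a b c d * (P a i * u i) * (P b j * v j) * (P c k * w k) * (P d l * z l) := by
    simp only [quad, frameTensor, Finset.sum_mul]
    refine Finset.sum_congr rfl fun i _ ↦ Finset.sum_congr rfl fun k _ ↦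
        Finset.sum_congr rfl fun a _ ↦ Finset.sum_congr rfl fun b _ ↦
        Finset.sum_congr rfl fun c _ ↦ Finset.sum_congr rfl fun d _ ↦
        Finset.sum_congr rfl fun c _ ↦ Finset.sum_congr rfl fun d _ ↦ by ring
  rw [hl, this]
  simp only [quad, Matrix.mulVec, dotProduct]
  refine Finset.sum_congr rfl fun a _ ↦ Finset.sum_congr rfl fun b _ ↦
    Finset.sum_congr rfl fun c _ ↦ Finset.sum_congr rfl fun d _ ↦ ?_
  simp only [← Finset.mul_sum, ← Finset.sum_mul]

end quad

/-- A polynomial function of degree at most four over `ℂ` such that one of any two of its values at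
distinct points vanishes is zero. -/
theorem quartic_coeff_eq_zero {A B C D E : ℂ}
    (h : ∀ t s : ℂ, t ≠ s → A + B * t + C * t ^ 2 + D * t ^ 3 + E * t ^ 4 = 0 ∨
      A + B * s + C * s ^ 2 + D * s ^ 3 + E * s ^ 4 = 0) :
    A = 0 ∧ B = 0 ∧ C = 0 ∧ D = 0 ∧ E = 0 := by
  set p : Polynomial ℂ := Polynomial.C A + Polynomial.C B * Polynomial.X +
    Polynomial.C C * Polynomial.X ^ 2 + Polynomial.C D * Polynomial.X ^ 3 +
    Polynomial.C E * Polynomial.X ^ 4 with hp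
  have hev : ∀ t, p.eval t = A + B * t + C * t ^ 2 + D * t ^ 3 + E * t ^ 4 := fun t ↦ by simp [hp]
  have hp0 : p = 0 := by
    by_contra hne
    obtain ⟨t, ht⟩ := Infinite.exists_notMem_finset p.roots.toFinset
    obtain ⟨s, hs⟩ := Infinite.exists_notMem_finset (insert t p.roots.toFinset)
    simp only [Finset.mem_insert, Multiset.mem_toFinset, Polynomial.mem_roots hne,
      Polynomial.IsRoot, not_or, hev] at ht hs
    rcases h t s (Ne.symm hs.1) with h | h
    · exact ht h
    · exact hs.2 h
  have hc : ∀ n, p.coeff n = 0 := fun n ↦ by simp [hp0]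
  refine ⟨?_, ?_, ?_, ?_, ?_⟩
  · simpa [hp, Polynomial.coeff_X, Polynomial.coeff_X_pow, Polynomial.coeff_C] using hc 0
  · simpa [hp, Polynomial.coeff_X, Polynomial.coeff_X_pow, Polynomial.coeff_C] using hc 1
  · simpa [hp, Polynomial.coeff_X, Polynomial.coeff_X_pow, Polynomial.coeff_C] using hc 2
  · simpa [hp, Polynomial.coeff_X, Polynomial.coeff_X_pow, Polynomial.coeff_C] using hc 3
  · simpa [hp, Polynomial.coeff_X, Polynomial.coeff_X_pow, Polynomial.coeff_C] using hc 4

/-- A Weyl tensor such that `C(X, Y, X, Y)` vanishes on one of any two distinct planes of the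
family spanned by `X = l + t m'` and `Y = m - t n` annihilates the bivectors
`l ∧ m`, `n ∧ m'` and `l ∧ n + m ∧ m'`: these span the space of bivectors generated by the
family. -/
theorem IsWeylTensor.components_eq_zero {C : Fin 4 → Fin 4 → Fin 4 → Fin 4 → ℂ}
    (hC : IsWeylTensor nullGram C)
    (h : ∀ t s : ℂ, t ≠ s →
      quad C ![1, 0, 0, t] ![0, -t, 1, 0] ![1, 0, 0, t] ![0, -t, 1, 0] = 0 ∨
      quad C ![1, 0, 0, s] ![0, -s, 1, 0] ![1, 0, 0, s] ![0, -s, 1, 0] = 0) (c d : Fin 4) :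
    C 0 2 c d = 0 ∧ C 1 3 c d = 0 ∧ C 0 1 c d = -C 2 3 c d := by
  have hQ : ∀ t, quad C ![1, 0, 0, t] ![0, -t, 1, 0] ![1, 0, 0, t] ![0, -t, 1, 0] =
      C 0 2 0 2 + (C 3 2 0 2 - C 0 1 0 2 + C 0 2 3 2 - C 0 2 0 1) * t +
      (C 3 2 3 2 + C 0 1 0 1 - C 3 1 0 2 - C 0 2 3 1 - C 3 2 0 1 - C 0 1 3 2) * t ^ 2 +
      (C 3 1 0 1 + C 0 1 3 1 - C 3 1 3 2 - C 3 2 3 1) * t ^ 3 + C 3 1 3 1 * t ^ 4 := by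
    intro t
    simp [quad, Fin.sum_univ_four]
    ring
  simp only [hQ] at h
  obtain ⟨q0, q1, q2, q3, q4⟩ := quartic_coeff_eq_zero h
  have ht : ∀ b d, C 0 b 1 d + C 1 b 0 d + C 2 b 3 d + C 3 b 2 d = 0 := by
    intro b d
    have := hC.trace b d
    simpa [Fin.sum_univ_four, nullGram, add_assoc] using this
  -- the symmetries reduce everything to the components `C a b c d` with `a < b`, `c < d` and
  -- `a b` not after `c d`
  have d1 : ∀ a c d, C a a c d = 0 := fun a c d ↦ by
    linear_combination (1 / 2 : ℂ) * hC.swap_left a a c d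
  have d2 : ∀ a c d, C c d a a = 0 := fun a c d ↦ by
    linear_combination (1 / 2 : ℂ) * hC.swap_right c d a a
  have l10 := hC.swap_left 1 0
  have l20 := hC.swap_left 2 0
  have l30 := hC.swap_left 3 0
  have l21 := hC.swap_left 2 1
  have l31 := hC.swap_left 3 1
  have l32 := hC.swap_left 3 2
  have r10 := fun a b ↦ hC.swap_right a b 1 0
  have r20 := fun a b ↦ hC.swap_right a b 2 0
  have r30 := fun a b ↦ hC.swap_right a b 3 0
  have r21 := fun a b ↦ hC.swap_right a b 2 1
  have r31 := fun a b ↦ hC.swap_right a b 3 1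
  have r32 := fun a b ↦ hC.swap_right a b 3 2
  have p1 := hC.pair_symm 0 2 0 1
  have p4 := hC.pair_symm 1 3 0 1
  have p5 := hC.pair_symm 2 3 0 1
  have p6 := hC.pair_symm 0 3 0 2
  have p7 := hC.pair_symm 1 2 0 2
  have p8 := hC.pair_symm 1 3 0 2
  have p9 := hC.pair_symm 2 3 0 2
  have p10 := hC.pair_symm 1 2 0 3
  have p11 := hC.pair_symm 1 3 0 3
  have p12 := hC.pair_symm 2 3 0 3
  have p13 := hC.pair_symm 1 3 1 2
  have p14 := hC.pair_symm 2 3 1 2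
  have p15 := hC.pair_symm 2 3 1 3
  have b := hC.bianchi 0 1 2 3
  have t00 := ht 0 0
  have t11 := ht 1 1
  have t22 := ht 2 2
  have t33 := ht 3 3
  have t01 := ht 0 1
  have t02 := ht 0 2
  have t03 := ht 0 3
  have t12 := ht 1 2
  have t13 := ht 1 3
  have t23 := ht 2 3
  simp only [d1, d2, l10, l20, l30, l21, l31, l32, r20, r30, r21, r31, r32, p1, p4, p5, p6, p7, p8,
    p9, p10, p11, p13, p15]
    at q0 q1 q2 q3 q4 b t00 t11 t22 t33 t01 t02 t03 t12 t13 t23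
  fin_cases c <;> fin_cases d <;>
    simp only [Fin.zero_eta, Fin.mk_one, Fin.reduceFinMk, d2, r10, r20, r30, r21, r31, r32, p1, p4,
      p5, p8, p9, p11, p12, p13, p14, p15] <;>
    grind

/-! ### Vector fields in a chart -/

section Chart

variable {M : Type*} [TopologicalSpace M] [ChartedSpace E4 M] [IsManifold (𝓡 4) ∞ M]

theorem two_le_infty : (2 : WithTop ℕ∞) ≤ ∞ := WithTop.coe_le_coe.2 le_top

theorem three_le_infty : (2 : WithTop ℕ∞) + 1 ≤ ∞ := WithTop.coe_le_coe.2 le_top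

/-- The vector field with constant components `v` in the preferred chart at `x`. -/
def coordField (x : M) (v : E4) (p : M) : TangentSpace (𝓡 4) p :=
  mfderiv 𝓘(ℝ, E4) (𝓡 4) (extChartAt (𝓡 4) x).symm (extChartAt (𝓡 4) x p) v

/-- The vector field `X` in the preferred chart at `x`. -/
def chartField (x : M) (X : ∀ p : M, TangentSpace (𝓡 4) p) : E4 → E4 :=
  VectorField.mpullback 𝓘(ℝ, E4) (𝓡 4) (extChartAt (𝓡 4) x).symm X

theorem isInvertible_mfderiv_symm (x : M) {y : E4} (hy : y ∈ (extChartAt (𝓡 4) x).target) :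
    (mfderiv 𝓘(ℝ, E4) (𝓡 4) (extChartAt (𝓡 4) x).symm y).IsInvertible := by
  have := isInvertible_mfderivWithin_extChartAt_symm (I := 𝓡 4) hy
  rwa [modelWithCornersSelf_coe, Set.range_id, mfderivWithin_univ] at this

theorem mfderiv_symm_self (x : M) :
    mfderiv 𝓘(ℝ, E4) (𝓡 4) (extChartAt (𝓡 4) x).symm (extChartAt (𝓡 4) x x) =
      ContinuousLinearMap.id ℝ E4 := by
  have := mfderivWithin_range_extChartAt_symm (I := 𝓡 4) (x := x)
  rwa [modelWithCornersSelf_coe, Set.range_id, mfderivWithin_univ] at this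

theorem smoothOn_coordField (x : M) (v : E4) :
    SmoothOn (chartAt E4 x).source (coordField x v) := by
  have h := Bundle.Trivialization.contMDiffOn_section_baseSet_iff
    (trivializationAt E4 (TangentSpace (𝓡 4) : M → Type _) x)
    (IB := 𝓡 4) (n := ∞) (s := coordField x v)
  rw [SmoothOn]
  refine h.2 ((contMDiffOn_const (c := v)).congr ?_)
  intro p hp
  have hp' : p ∈ (chartAt E4 x).source := hp
  have e := TangentBundle.symmL_trivializationAt (I := 𝓡 4) hp'
  rw [modelWithCornersSelf_coe, Set.range_id, mfderivWithin_univ] at e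
  have e' : coordField x v p =
      (trivializationAt E4 (TangentSpace (𝓡 4) : M → Type _) x).symm p v :=
    ((congrArg (fun L : E4 →L[ℝ] TangentSpace (𝓡 4) p ↦ L v) e).symm).trans
      (Bundle.Trivialization.symmL_apply _ hp v)
  rw [e', Bundle.Trivialization.apply_mk_symm _ hp]

theorem contMDiffAt_symm (x : M) {y : E4} (hy : y ∈ (extChartAt (𝓡 4) x).target) :
    ContMDiffAt 𝓘(ℝ, E4) (𝓡 4) ∞ (extChartAt (𝓡 4) x).symm y :=
  (contMDiffOn_extChartAt_symm x).contMDiffAt ((isOpen_extChartAt_target x).mem_nhds hy)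

theorem contDiffAt_chartField (x : M) {X : ∀ p : M, TangentSpace (𝓡 4) p} {U : Set M}
    (hU : IsOpen U) (hX : SmoothOn U X) {y : E4} (hy : y ∈ (extChartAt (𝓡 4) x).target)
    (hyU : (extChartAt (𝓡 4) x).symm y ∈ U) : ContDiffAt ℝ 2 (chartField x X) y := by
  have h1 := (hX.contMDiffAt (hU.mem_nhds hyU)).of_le (m := 2) two_le_infty
  have h2 := h1.mpullback_vectorField_preimage (contMDiffAt_symm x hy)
    (isInvertible_mfderiv_symm x hy) (m := 2) (n := ∞) three_le_infty
  exact (contMDiffAt_vectorSpace_iff_contDiffAt).1 h2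

theorem chartField_mlieBracket (x : M) {X Y : ∀ p : M, TangentSpace (𝓡 4) p} {U : Set M}
    (hU : IsOpen U) (hX : SmoothOn U X) (hY : SmoothOn U Y) {y : E4}
    (hy : y ∈ (extChartAt (𝓡 4) x).target) (hyU : (extChartAt (𝓡 4) x).symm y ∈ U) :
    chartField x (VectorField.mlieBracket (𝓡 4) X Y) y =
      fderiv ℝ (chartField x Y) y (chartField x X y) -
        fderiv ℝ (chartField x X) y (chartField x Y y) := by
  have : IsManifold (𝓡 4) (minSmoothness ℝ 2) M :=
    IsManifold.of_le (n := ∞) (by simpa using two_le_infty)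
  have hX' := (hX.contMDiffAt (hU.mem_nhds hyU)).mdifferentiableAt (by simp)
  have hY' := (hY.contMDiffAt (hU.mem_nhds hyU)).mdifferentiableAt (by simp)
  have := VectorField.mpullback_mlieBracket hX' hY' (contMDiffAt_symm x hy)
    (by simpa using two_le_infty)
  have h2 := VectorField.mlieBracketWithin_eq_lieBracketWithin (𝕜 := ℝ) (V := chartField x X)
    (W := chartField x Y) (s := Set.univ)
  have h3 := VectorField.mlieBracketWithin_univ.symm.trans
    (h2.trans VectorField.lieBracketWithin_univ)
  exact this.trans (congrFun h3 y)

theorem mfderiv_chartField (x : M) (X : ∀ p : M, TangentSpace (𝓡 4) p) {y : E4}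
    (hy : y ∈ (extChartAt (𝓡 4) x).target) :
    mfderiv 𝓘(ℝ, E4) (𝓡 4) (extChartAt (𝓡 4) x).symm y (chartField x X y) =
      X ((extChartAt (𝓡 4) x).symm y) := by
  rw [chartField, VectorField.mpullback_apply]
  exact (isInvertible_mfderiv_symm x hy).self_apply_inverse _

theorem chartField_self (x : M) (X : ∀ p : M, TangentSpace (𝓡 4) p) :
    chartField x X (extChartAt (𝓡 4) x x) = X x := by
  have := mfderiv_chartField x X (mem_extChartAt_target x)
  rw [mfderiv_symm_self, extChartAt_to_inv] at this
  exact this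

theorem coordField_self (x : M) (v : E4) : coordField x v x = v := by
  rw [coordField, mfderiv_symm_self]
  rfl

/-! ### The metric in a chart -/

theorem stdBasis_apply (i k : Fin 4) : (stdBasis i) k = if k = i then (1 : ℝ) else 0 := by
  simp [stdBasis]

theorem eq_sum_stdBasis (a : E4) : a = ∑ i, a i • stdBasis i := by
  ext k
  simp [stdBasis_apply]

theorem PseudoMetric.val_mfderiv_symm (g : PseudoMetric M) (x : M) (y a b : E4) :
    g.val ((extChartAt (𝓡 4) x).symm y)
      (mfderiv 𝓘(ℝ, E4) (𝓡 4) (extChartAt (𝓡 4) x).symm y a)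
      (mfderiv 𝓘(ℝ, E4) (𝓡 4) (extChartAt (𝓡 4) x).symm y b) =
      ∑ i, ∑ j, coordMetric g x y i j * a i * b j := by
  set L : E4 →L[ℝ] TangentSpace (𝓡 4) ((extChartAt (𝓡 4) x).symm y) :=
    mfderiv 𝓘(ℝ, E4) (𝓡 4) (extChartAt (𝓡 4) x).symm y with hL
  have h : ∀ c : E4, L c = ∑ i, c i • L (stdBasis i) := by
    intro c
    exact (congrArg L (eq_sum_stdBasis c)).trans ((map_sum L _ _).trans
      (Finset.sum_congr rfl fun i _ ↦ map_smul L _ _))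
  change g.val _ (L a) (L b) = _
  rw [h a, h b]
  simp only [map_sum, map_smul, sum_apply, smul_apply,
    smul_eq_mul, Finset.mul_sum]
  rw [Finset.sum_comm]
  refine Finset.sum_congr rfl fun i _ ↦ Finset.sum_congr rfl fun j _ ↦ ?_
  change _ = g.val _ (L (stdBasis i)) (L (stdBasis j)) * a i * b j
  ring

theorem PseudoMetric.isMetricAt_coordMetric (g : PseudoMetric M) (x : M) {y : E4}
    (hy : y ∈ (extChartAt (𝓡 4) x).target) : IsMetricAt (coordMetric g x) y where
  smooth i j := by
    have hsrc : (extChartAt (𝓡 4) x).symm y ∈ (chartAt E4 x).source := by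
      rw [← extChartAt_source (𝓡 4)]
      exact (extChartAt (𝓡 4) x).map_target hy
    have hs := fun v ↦ (smoothOn_coordField x v).contMDiffAt
      ((chartAt E4 x).open_source.mem_nhds hsrc)
    have h1 := ContMDiffAt.clm_bundle_apply₂ (F₁ := E4) (F₂ := E4) (F₃ := ℝ)
      (E₃ := Bundle.Trivial M ℝ)
      (g.contMDiff ((extChartAt (𝓡 4) x).symm y)) (hs (stdBasis i)) (hs (stdBasis j))
    have h2 : ContMDiffAt (𝓡 4) 𝓘(ℝ, ℝ) ∞
        (fun p ↦ g.val p (coordField x (stdBasis i) p) (coordField x (stdBasis j) p))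
        ((extChartAt (𝓡 4) x).symm y) := by
      simp only [Bundle.contMDiffAt_totalSpace] at h1
      exact h1.2
    have h3 := (h2.comp y (contMDiffAt_symm x hy)).of_le two_le_infty
    refine h3.contDiffAt.congr_of_eventuallyEq ?_
    filter_upwards [(isOpen_extChartAt_target x).mem_nhds hy] with z hz
    simp only [Function.comp, coordField, coordMetric, Matrix.of_apply]
    rw [(extChartAt (𝓡 4) x).right_inv hz]
  symm := Filter.Eventually.of_forall fun z a b ↦ g.symm _ _ _
  det_ne_zero := by
    intro hdet
    obtain ⟨v, hv, hGv⟩ := Matrix.exists_mulVec_eq_zero_iff.2 hdet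
    set L : E4 →L[ℝ] TangentSpace (𝓡 4) ((extChartAt (𝓡 4) x).symm y) :=
      mfderiv 𝓘(ℝ, E4) (𝓡 4) (extChartAt (𝓡 4) x).symm y with hL
    have hinv : L.IsInvertible := isInvertible_mfderiv_symm x hy
    have hLa : L (WithLp.toLp 2 v) = 0 := by
      refine g.nondegenerate _ _ fun w ↦ ?_
      rw [g.symm, ← hinv.self_apply_inverse w]
      refine (g.val_mfderiv_symm x y (L.inverse w) (WithLp.toLp 2 v)).trans ?_
      refine Finset.sum_eq_zero fun i _ ↦ ?_
      have := congrFun hGv i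
      simp only [Matrix.mulVec, dotProduct, Pi.zero_apply] at this
      calc _ = (L.inverse w) i * ∑ j, coordMetric g x y i j * v j := by
            rw [Finset.mul_sum]
            exact Finset.sum_congr rfl fun j _ ↦ by
              change coordMetric g x y i j * (L.inverse w) i * v j = _
              ring
        _ = 0 := by rw [this, mul_zero]
    have h0 : (WithLp.toLp 2 v : E4) = 0 := hinv.injective (by rw [hLa, map_zero])
    apply hv
    ext j
    exact congrArg (fun a : E4 ↦ a j) h0

theorem PseudoMetric.coordMetric_self (g : PseudoMetric M) (x : M) :
    coordMetric g x (extChartAt (𝓡 4) x x) = g.gram x := by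
  ext i j
  have key : ∀ p, p = x → ∀ L : E4 →L[ℝ] E4, L = ContinuousLinearMap.id ℝ E4 →
      (g.val p : E4 →L[ℝ] E4 →L[ℝ] ℝ) (L (stdBasis i)) (L (stdBasis j)) = g.gram x i j := by
    rintro p rfl L rfl
    rfl
  exact key _ (extChartAt_to_inv x) _ (mfderiv_symm_self x)

/-! ### Complex vector fields in a chart -/

/-- The components of a complex tangent vector at `x`. -/
def complexCoord {p : M} (z : ℂ ⊗[ℝ] TangentSpace (𝓡 4) p) (k : Fin 4) : ℂ :=
  (((rePart z : E4) k : ℝ) : ℂ) + Complex.I * (((imPart z : E4) k : ℝ) : ℂ)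

/-- The components of a complex vector field in the preferred chart at `x`. -/
def chartComplex (x : M) (Z : ComplexField M) (k : Fin 4) (y : E4) : ℂ :=
  ((chartField x (fun p ↦ rePart (Z p)) y k : ℝ) : ℂ) +
    Complex.I * ((chartField x (fun p ↦ imPart (Z p)) y k : ℝ) : ℂ)

theorem chartComplex_self (x : M) (Z : ComplexField M) (k : Fin 4) :
    chartComplex x Z k (extChartAt (𝓡 4) x x) = complexCoord (Z x) k := by
  rw [chartComplex, complexCoord, chartField_self, chartField_self]
  rfl

theorem rePart_mkComplex {V : Type*} [AddCommGroup V] [Module ℝ V] (v w : V) :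
    rePart (mkComplex v w) = v := by
  simp [mkComplex, rePart]

theorem imPart_mkComplex {V : Type*} [AddCommGroup V] [Module ℝ V] (v w : V) :
    imPart (mkComplex v w) = w := by
  simp [mkComplex, imPart]

theorem PseudoMetric.complexified_mkComplex (g : PseudoMetric M) (p : M)
    (a b c d : TangentSpace (𝓡 4) p) :
    g.complexified p (mkComplex a b) (mkComplex c d) =
      ((g.val p a c - g.val p b d : ℝ) : ℂ) +
        Complex.I * ((g.val p a d + g.val p b c : ℝ) : ℂ) := by
  simp only [complexified, mkComplex, map_add, LinearMap.add_apply,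
    LinearMap.BilinForm.baseChange_tmul]
  simp
  ring_nf

theorem PseudoMetric.pair_chartComplex (g : PseudoMetric M) (x : M) (Z W : ComplexField M) {y : E4}
    (hy : y ∈ (extChartAt (𝓡 4) x).target) :
    pair (fun a b ↦ (coordMetric g x y a b : ℂ)) (fun a ↦ chartComplex x Z a y)
      (fun a ↦ chartComplex x W a y) =
      g.complexified ((extChartAt (𝓡 4) x).symm y) (Z ((extChartAt (𝓡 4) x).symm y))
        (W ((extChartAt (𝓡 4) x).symm y)) := by
  rw [← mkComplex_rePart_imPart (Z _), ← mkComplex_rePart_imPart (W _), complexified_mkComplex]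
  have h : ∀ X Y : (∀ p : M, TangentSpace (𝓡 4) p),
      g.val ((extChartAt (𝓡 4) x).symm y) (X _) (Y _) =
        ∑ i, ∑ j, coordMetric g x y i j * chartField x X y i * chartField x Y y j := by
    intro X Y
    rw [← g.val_mfderiv_symm, mfderiv_chartField x X hy, mfderiv_chartField x Y hy]
  rw [h (fun p ↦ rePart (Z p)) fun p ↦ rePart (W p), h (fun p ↦ imPart (Z p)) fun p ↦ imPart (W p),
    h (fun p ↦ rePart (Z p)) fun p ↦ imPart (W p), h (fun p ↦ imPart (Z p)) fun p ↦ rePart (W p)]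
  push_cast
  simp only [pair, chartComplex, Finset.mul_sum, ← Finset.sum_add_distrib,
    ← Finset.sum_sub_distrib]
  refine Finset.sum_congr rfl fun i _ ↦ Finset.sum_congr rfl fun j _ ↦ ?_
  ring_nf
  simp
  ring

theorem contDiffAt_apply {X : E4 → E4} {y : E4} (hX : ContDiffAt ℝ 2 X y) (k : Fin 4) :
    ContDiffAt ℝ 2 (fun z ↦ X z k) y :=
  (EuclideanSpace.proj (𝕜 := ℝ) k).contDiff.contDiffAt.comp y hX

theorem contDiffAt_chartComplex (x : M) {Z : ComplexField M} {U : Set M} (hU : IsOpen U)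
    (hZ : ComplexSmoothOn U Z) {y : E4} (hy : y ∈ (extChartAt (𝓡 4) x).target)
    (hyU : (extChartAt (𝓡 4) x).symm y ∈ U) (k : Fin 4) :
    ContDiffAt ℝ 2 (chartComplex x Z k) y := by
  have h1 := contDiffAt_apply (contDiffAt_chartField x hU hZ.1 hy hyU) k
  have h2 := contDiffAt_apply (contDiffAt_chartField x hU hZ.2 hy hyU) k
  exact (Complex.ofRealCLM.contDiff.contDiffAt.comp y h1).add
    (contDiffAt_const.mul (Complex.ofRealCLM.contDiff.contDiffAt.comp y h2))

/-- The Lie bracket of complex vector fields is computed in a chart by the coordinate formula. -/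
theorem coordBracket_chartComplex (x : M) {Z W : ComplexField M} {U : Set M} (hU : IsOpen U)
    (hZ : ComplexSmoothOn U Z) (hW : ComplexSmoothOn U W) {y : E4}
    (hy : y ∈ (extChartAt (𝓡 4) x).target)
    (hyU : (extChartAt (𝓡 4) x).symm y ∈ U) (k : Fin 4) :
    coordBracket (chartComplex x Z) (chartComplex x W) k y =
      chartComplex x (complexBracket Z W) k y := by
  -- the derivative of a component of a real field in the direction of a real vector
  have hdir : ∀ (X : E4 → E4), ContDiffAt ℝ 2 X y → ∀ v : E4,
      ∑ i, v i * pderiv i (fun z ↦ X z k) y = (fderiv ℝ X y v) k := by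
    intro X hX v
    have hd := hX.differentiableAt (by norm_num)
    have hf : HasFDerivAt (fun z ↦ X z k)
        ((EuclideanSpace.proj (𝕜 := ℝ) k : E4 →L[ℝ] ℝ).comp (fderiv ℝ X y)) y :=
      (EuclideanSpace.proj (𝕜 := ℝ) k).hasFDerivAt.comp y hd.hasFDerivAt
    simp only [pderiv, hf.fderiv]
    conv_rhs => rw [eq_sum_stdBasis v]
    simp
  have hder : ∀ Z : ComplexField M, ComplexSmoothOn U Z → ∀ i,
      cpderiv i (chartComplex x Z k) y =
        (pderiv i (fun z ↦ chartField x (fun p ↦ rePart (Z p)) z k) y : ℂ) +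
        Complex.I * (pderiv i (fun z ↦ chartField x (fun p ↦ imPart (Z p)) z k) y : ℂ) := by
    intro Z hZ i
    have h1 := (contDiffAt_apply (contDiffAt_chartField x hU hZ.1 hy hyU) k).differentiableAt
      (by norm_num)
    have h2 := (contDiffAt_apply (contDiffAt_chartField x hU hZ.2 hy hyU) k).differentiableAt
      (by norm_num)
    have h1' := Complex.ofRealCLM.differentiableAt.comp y h1
    have h2' := Complex.ofRealCLM.differentiableAt.comp y h2
    rw [← cpderiv_ofReal i h1, ← cpderiv_ofReal i h2]
    have hc : cpderiv i (fun _ ↦ Complex.I) y = 0 := by simp [cpderiv]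
    unfold chartComplex
    refine (cpderiv_add i h1' ((differentiableAt_const Complex.I).fun_mul h2')).trans ?_
    congr 1
    refine (cpderiv_mul i (differentiableAt_const Complex.I) h2').trans ?_
    rw [hc, zero_mul, zero_add]
    rfl
  have hZr := contDiffAt_chartField x hU hZ.1 hy hyU
  have hZi := contDiffAt_chartField x hU hZ.2 hy hyU
  have hWr := contDiffAt_chartField x hU hW.1 hy hyU
  have hWi := contDiffAt_chartField x hU hW.2 hy hyU
  have hsub : ∀ X Y : (∀ p : M, TangentSpace (𝓡 4) p),
      chartField x (fun p ↦ X p - Y p) y = chartField x X y - chartField x Y y := fun X Y ↦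
    map_sub (mfderiv 𝓘(ℝ, E4) (𝓡 4) (extChartAt (𝓡 4) x).symm y).inverse _ _
  have hadd : ∀ X Y : (∀ p : M, TangentSpace (𝓡 4) p),
      chartField x (fun p ↦ X p + Y p) y = chartField x X y + chartField x Y y := fun X Y ↦
    map_add (mfderiv 𝓘(ℝ, E4) (𝓡 4) (extChartAt (𝓡 4) x).symm y).inverse _ _
  simp only [coordBracket, hder Z hZ, hder W hW]
  rw [chartComplex]
  simp only [complexBracket, rePart_mkComplex, imPart_mkComplex]
  rw [hsub (VectorField.mlieBracket (𝓡 4) (fun p ↦ rePart (Z p)) fun p ↦ rePart (W p))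
      (VectorField.mlieBracket (𝓡 4) (fun p ↦ imPart (Z p)) fun p ↦ imPart (W p)),
    hadd (VectorField.mlieBracket (𝓡 4) (fun p ↦ rePart (Z p)) fun p ↦ imPart (W p))
      (VectorField.mlieBracket (𝓡 4) (fun p ↦ imPart (Z p)) fun p ↦ rePart (W p)),
    chartField_mlieBracket x hU hZ.1 hW.1 hy hyU, chartField_mlieBracket x hU hZ.2 hW.2 hy hyU,
    chartField_mlieBracket x hU hZ.1 hW.2 hy hyU, chartField_mlieBracket x hU hZ.2 hW.1 hy hyU]
  simp only [PiLp.sub_apply, PiLp.add_apply, ← hdir _ hZr, ← hdir _ hZi, ← hdir _ hWr,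
    ← hdir _ hWi]
  push_cast
  simp only [chartComplex, Finset.mul_sum, ← Finset.sum_add_distrib, ← Finset.sum_sub_distrib]
  refine Finset.sum_congr rfl fun i _ ↦ ?_
  ring_nf
  simp
  ring

end Chart

/-! ### Curvature on half-integrable eigenbundles -/

/-- The `1`-eigenspace of an anti-isometric involution is its own orthogonal complement. -/
theorem apply_eq_self_of_orthogonal {W : Type*} [AddCommGroup W] [Module ℂ W]
    {B : LinearMap.BilinForm ℂ W} {K : Module.End ℂ W} (hB : ∀ z, (∀ w, B z w = 0) → z = 0)
    (hK : K * K = 1) (hanti : ∀ X Y, B (K X) (K Y) = -B X Y) {w : W}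
    (hw : ∀ v, K v = v → B w v = 0) : K w = w := by
  have hKK : ∀ v, K (K v) = v := fun v ↦ by rw [← Module.End.mul_apply, hK, Module.End.one_apply]
  have hd : w - K w = 0 := by
    refine hB _ fun v ↦ ?_
    have h1 : B (w - K w) (v - K v) = 0 := by
      have h := hanti (w - K w) (v - K v)
      simp only [map_sub, hKK, LinearMap.sub_apply] at h ⊢
      linear_combination (1 / 2 : ℂ) * h
    have h2 : B (w - K w) (v + K v) = 0 := by
      have h := hw (v + K v) (by rw [map_add, hKK, add_comm])
      have h3 := hanti w v
      have h4 := hanti w (K v)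
      rw [hKK] at h4
      simp only [map_sub, map_add, LinearMap.sub_apply] at h ⊢
      linear_combination 2 * h - h3 - h4
    simp only [map_sub, map_add, LinearMap.sub_apply] at h1 h2 ⊢
    linear_combination (1 / 2 : ℂ) * h1 + (1 / 2 : ℂ) * h2
  exact (sub_eq_zero.1 hd).symm

section Eigenbundle

variable {M : Type*} [TopologicalSpace M] [ChartedSpace E4 M]

theorem rePart_sum_tmul {V : Type*} [AddCommGroup V] [Module ℝ V] (u : Fin 4 → ℂ) (b : Fin 4 → V) :
    rePart (∑ a, u a ⊗ₜ[ℝ] b a) = ∑ a, (u a).re • b a := by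
  simp [rePart]

theorem imPart_sum_tmul {V : Type*} [AddCommGroup V] [Module ℝ V] (u : Fin 4 → ℂ) (b : Fin 4 → V) :
    imPart (∑ a, u a ⊗ₜ[ℝ] b a) = ∑ a, (u a).im • b a := by
  simp [imPart]

/-- The complex tangent vector at `x` with components `u`. -/
def ofComplexCoord (x : M) (u : Fin 4 → ℂ) : ℂ ⊗[ℝ] TangentSpace (𝓡 4) x :=
  ∑ a, u a ⊗ₜ[ℝ] tangentBasis x a

theorem complexCoord_ofComplexCoord (x : M) (u : Fin 4 → ℂ) :
    complexCoord (ofComplexCoord x u) = u := by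
  have h1 : (rePart (ofComplexCoord x u) : E4) = ∑ a, (u a).re • stdBasis a :=
    rePart_sum_tmul u (tangentBasis x)
  have h2 : (imPart (ofComplexCoord x u) : E4) = ∑ a, (u a).im • stdBasis a :=
    imPart_sum_tmul u (tangentBasis x)
  funext k
  rw [complexCoord, h1, h2]
  simp only [WithLp.ofLp_sum, WithLp.ofLp_smul, Finset.sum_apply, Pi.smul_apply, stdBasis_apply,
    smul_eq_mul, mul_ite, mul_one, mul_zero, Finset.sum_ite_eq, Finset.mem_univ, if_true]
  rw [mul_comm]
  exact Complex.re_add_im (u k)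

variable [IsManifold (𝓡 4) ∞ M]

theorem PseudoMetric.complexified_nondegenerate (g : PseudoMetric M) (x : M)
    (z : ℂ ⊗[ℝ] TangentSpace (𝓡 4) x) (hz : ∀ w, g.complexified x z w = 0) : z = 0 := by
  have h : ∀ v, g.val x (rePart z) v = 0 ∧ g.val x (imPart z) v = 0 := by
    intro v
    have := hz (mkComplex v 0)
    rw [← mkComplex_rePart_imPart z, g.complexified_mkComplex] at this
    have h1 := congrArg Complex.re this
    have h2 := congrArg Complex.im this
    simp at h1 h2
    exact ⟨h1, h2⟩
  rw [← mkComplex_rePart_imPart z, g.nondegenerate x _ fun v ↦ (h v).1,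
    g.nondegenerate x _ fun v ↦ (h v).2]
  simp [mkComplex]

/-- The complex vector field which has constant components in the preferred chart at `x` and the
value `v` at `x`. -/
def extendField (x : M) (v : ℂ ⊗[ℝ] TangentSpace (𝓡 4) x) : ComplexField M := fun p ↦
  mkComplex (coordField x (rePart v) p) (coordField x (imPart v) p)

theorem extendField_self (x : M) (v : ℂ ⊗[ℝ] TangentSpace (𝓡 4) x) : extendField x v x = v := by
  rw [extendField, coordField_self, coordField_self]
  exact mkComplex_rePart_imPart v

theorem complexSmoothOn_extendField (x : M) (v : ℂ ⊗[ℝ] TangentSpace (𝓡 4) x) :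
    ComplexSmoothOn (chartAt E4 x).source (extendField x v) := by
  constructor
  · simpa only [extendField, rePart_mkComplex] using smoothOn_coordField x (rePart v)
  · simpa only [extendField, imPart_mkComplex] using smoothOn_coordField x (imPart v)

theorem ComplexSmoothOn.add {U : Set M} {X Y : ComplexField M} (hX : ComplexSmoothOn U X)
    (hY : ComplexSmoothOn U Y) : ComplexSmoothOn U fun p ↦ X p + Y p := by
  constructor
  · simpa only [map_add] using! hX.1.add_section hY.1
  · simpa only [map_add] using! hX.2.add_section hY.2

theorem ComplexSmoothOn.mono {U V : Set M} {X : ComplexField M} (hX : ComplexSmoothOn U X)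
    (h : V ⊆ U) : ComplexSmoothOn V X :=
  ⟨ContMDiffOn.mono hX.1 h, ContMDiffOn.mono hX.2 h⟩

theorem PseudoMetric.pair_complexCoord (g : PseudoMetric M) (x : M)
    (z w : ℂ ⊗[ℝ] TangentSpace (𝓡 4) x) :
    pair (fun a b ↦ (g.gram x a b : ℂ)) (complexCoord z) (complexCoord w) =
      g.complexified x z w := by
  have h := g.pair_chartComplex x (extendField x z) (extendField x w) (mem_extChartAt_target x)
  have h' := congrArg (fun p ↦ g.complexified p (extendField x z p) (extendField x w p))
    (extChartAt_to_inv (I := 𝓡 4) x)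
  simp only [extendField_self] at h'
  rw [← h', ← h]
  simp only [chartComplex_self, extendField_self, g.coordMetric_self]

/-- If the `1`-eigenbundle of an anti-isometric involution `K` of `TM ⊗ ℂ` is involutive, the
curvature vanishes on it. -/
theorem sum_riemann_eq_zero (g : PseudoMetric M) {x : M} {U : Set M} (hU : IsOpen U) (hxU : x ∈ U)
    {K : ComplexEndField M} (hsmooth : EndSmoothOn U K) (hsq : ∀ p ∈ U, K p * K p = 1)
    (hanti : ∀ p ∈ U, ∀ X Y, g.complexified p (K p X) (K p Y) = -g.complexified p X Y)
    (hinv : InvolutiveOn U fun p ↦ (K p).eigenspace 1) {X Y : Fin 4 → ℂ}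
    (hX : K x (ofComplexCoord x X) = ofComplexCoord x X)
    (hY : K x (ofComplexCoord x Y) = ofComplexCoord x Y) :
    ∑ a, ∑ b, ∑ c, ∑ d, (riemann (coordMetric g x) a b c d (extChartAt (𝓡 4) x x) : ℂ) *
      X a * Y b * X c * Y d = 0 := by
  set V : Set M := U ∩ (chartAt E4 x).source with hV
  have hVo : IsOpen V := hU.inter (chartAt E4 x).open_source
  have hxV : x ∈ V := ⟨hxU, mem_chart_source E4 x⟩
  set y := extChartAt (𝓡 4) x x with hy
  have hnear : ∀ᶠ z in 𝓝 y, z ∈ (extChartAt (𝓡 4) x).target ∧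
      (extChartAt (𝓡 4) x).symm z ∈ V := by
    have ht : ∀ᶠ z in 𝓝 y, z ∈ (extChartAt (𝓡 4) x).target :=
      (isOpen_extChartAt_target x).mem_nhds (mem_extChartAt_target x)
    refine ht.and ?_
    have hc : ContinuousAt (extChartAt (𝓡 4) x).symm y := continuousAt_extChartAt_symm x
    exact hc.eventually (hVo.mem_nhds (by rw [hy, extChartAt_to_inv]; exact hxV))
  -- the sections of the eigenbundle near `x`
  set T : Set (ComplexField M) := {Z | ComplexSmoothOn V Z ∧ ∀ p ∈ V, K p (Z p) = Z p} with hT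
  -- every eigenvector at `x` extends to a local section: project a smooth extension
  have hext : ∀ v, K x v = v → ∃ Z ∈ T, Z x = v := by
    intro v hv
    set E := extendField x ((1 / 2 : ℂ) • v) with hE
    have hEs : ComplexSmoothOn V E := (complexSmoothOn_extendField x _).mono Set.inter_subset_right
    refine ⟨fun p ↦ E p + K p (E p), ⟨hEs.add (hsmooth V hVo Set.inter_subset_left E hEs),
      fun p hp ↦ ?_⟩, ?_⟩
    · rw [map_add, ← Module.End.mul_apply, hsq p hp.1, Module.End.one_apply, add_comm]
    · simp only [hE, extendField_self, map_smul, hv]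
      rw [← add_smul]
      norm_num
  have hnull : ∀ Z ∈ T, ∀ W ∈ T, ∀ p ∈ V, g.complexified p (Z p) (W p) = 0 := by
    intro Z hZ W hW p hp
    have := hanti p hp.1 (Z p) (W p)
    rw [hZ.2 p hp, hW.2 p hp] at this
    linear_combination (1 / 2 : ℂ) * this
  have hS : IsNullInvolutiveAt (fun a b z ↦ (coordMetric g x z a b : ℂ))
      (chartComplex x '' T) y := by
    constructor
    · rintro _ ⟨Z, hZ, rfl⟩ k
      exact contDiffAt_chartComplex x hVo hZ.1 hnear.self_of_nhds.1 hnear.self_of_nhds.2 k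
    · rintro _ ⟨Z, hZ, rfl⟩ _ ⟨W, hW, rfl⟩
      filter_upwards [hnear] with z hz
      rw [g.pair_chartComplex x Z W hz.1]
      exact hnull Z hZ W hW _ hz.2
    · rintro _ ⟨Z, hZ, rfl⟩ _ ⟨W, hW, rfl⟩ _ ⟨N, hN, rfl⟩
      filter_upwards [hnear] with z hz
      simp only [coordBracket_chartComplex x hVo hZ.1 hW.1 hz.1 hz.2]
      rw [g.pair_chartComplex x _ N hz.1]
      have hb := hinv V hVo Set.inter_subset_left Z W hZ.1 hW.1
        (fun p hp ↦ by rw [Module.End.mem_eigenspace_iff, one_smul]; exact hZ.2 p hp)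
        (fun p hp ↦ by rw [Module.End.mem_eigenspace_iff, one_smul]; exact hW.2 p hp) _ hz.2
      rw [Module.End.mem_eigenspace_iff, one_smul] at hb
      have := hanti _ hz.2.1 (complexBracket Z W ((extChartAt (𝓡 4) x).symm z)) (N _)
      rw [hb, hN.2 _ hz.2] at this
      linear_combination (1 / 2 : ℂ) * this
    · intro u hu
      have hw : K x (ofComplexCoord x u) = ofComplexCoord x u := by
        refine apply_eq_self_of_orthogonal (g.complexified_nondegenerate x) (hsq x hxU)
          (hanti x hxU) fun v hv ↦ ?_
        obtain ⟨Z, hZ, rfl⟩ := hext v hv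
        have := hu _ ⟨Z, hZ, rfl⟩
        simp only [hy, chartComplex_self, g.coordMetric_self] at this
        rw [← g.pair_complexCoord, complexCoord_ofComplexCoord]
        exact this
      obtain ⟨Z, hZ, hZx⟩ := hext _ hw
      refine ⟨_, ⟨Z, hZ, rfl⟩, fun a ↦ ?_⟩
      rw [hy, chartComplex_self, hZx, complexCoord_ofComplexCoord]
  have hmet := g.isMetricAt_coordMetric x (mem_extChartAt_target x)
  obtain ⟨Z, hZ, hZx⟩ := hext _ hX
  obtain ⟨W, hW, hWx⟩ := hext _ hY
  have hcurv := hS.pair_curvature_eq_zero (hmet.eventually.mono fun z hz ↦ hz.isLeviCivitaAt)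
    ⟨Z, hZ, rfl⟩ ⟨W, hW, rfl⟩ ⟨W, hW, rfl⟩ ⟨Z, hZ, rfl⟩
  simp only [hy, chartComplex_self, hZx, hWx, complexCoord_ofComplexCoord, hmet.curvature_eq]
    at hcurv
  rw [← hcurv]
  simp only [pair, riemann, Finset.mul_sum, Finset.sum_mul, Complex.ofReal_sum, Complex.ofReal_mul]
  have swap : ∀ H : Fin 4 → Fin 4 × Fin 4 × Fin 4 → ℂ, ∑ m, ∑ p, H m p = ∑ p, ∑ m, H m p :=
    fun H ↦ Finset.sum_comm
  conv_rhs => rw [Finset.sum_comm]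
  refine Finset.sum_congr rfl fun a _ ↦ ?_
  have := swap fun m p ↦ (coordMetric g x y a m : ℂ) *
    (riemannUp (coordMetric g x) m p.1 p.2.1 p.2.2 y : ℂ) * X a * Y p.1 * X p.2.1 * Y p.2.2
  simp only [Fintype.sum_prod_type] at this
  rw [← this]
  refine Finset.sum_congr rfl fun m _ ↦ Finset.sum_congr rfl fun b _ ↦
    Finset.sum_congr rfl fun c _ ↦ Finset.sum_congr rfl fun d _ ↦ ?_
  rw [(hmet.symm.self_of_nhds m a)]
  ring

end Eigenbundle

/-! ### Chirality in an adapted null frame -/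

section Chirality

variable {M : Type*} [TopologicalSpace M] [ChartedSpace E4 M] [IsManifold (𝓡 4) ∞ M]

/-- The matrix of the metric at `x`, with complex entries. -/
def PseudoMetric.gramC (g : PseudoMetric M) (x : M) : Matrix (Fin 4) (Fin 4) ℂ :=
  (g.gram x).map Complex.ofReal

open Classical in
/-- The component `ε_{0123}` of the volume form. -/
def volumeCoeff (g : PseudoMetric M) (o : ManifoldOrientation M) (x : M) : ℝ :=
  (if (tangentBasis x).orientation = o.val x then (1 : ℝ) else -1) * Real.sqrt |(g.gram x).det|

theorem volumeForm_tangentBasis (g : PseudoMetric M) (o : ManifoldOrientation M) (x : M)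
    (a b c d : Fin 4) :
    ((volumeForm g o x ![tangentBasis x a, tangentBasis x b, tangentBasis x c, tangentBasis x d] :
      ℝ) : ℂ) = volumeCoeff g o x * leviCivita a b c d := by
  have e : ((tangentBasis x).det ![tangentBasis x a, tangentBasis x b, tangentBasis x c,
      tangentBasis x d]) = ((1 : Matrix (Fin 4) (Fin 4) ℝ).submatrix id ![a, b, c, d]).det := by
    rw [Module.Basis.det_apply]
    congr 1
    ext i j
    rw [Module.Basis.toMatrix_apply]
    fin_cases j <;> simp [Matrix.one_apply, Finsupp.single_apply, eq_comm]
  have e2 : leviCivita a b c d =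
      ((((1 : Matrix (Fin 4) (Fin 4) ℝ).submatrix id ![a, b, c, d]).det : ℝ) : ℂ) := by
    rw [leviCivita]
    have := Complex.ofRealHom.map_det ((1 : Matrix (Fin 4) (Fin 4) ℝ).submatrix id ![a, b, c, d])
    refine Eq.trans ?_ this.symm
    congr 1
    ext i j
    simp [Matrix.one_apply]
  rw [e2, ← e, volumeForm, AlternatingMap.smul_apply, smul_eq_mul, Complex.ofReal_mul, volumeCoeff]

theorem PseudoMetric.isMetricAt_self (g : PseudoMetric M) (x : M) :
    IsMetricAt (coordMetric g x) (extChartAt (𝓡 4) x x) :=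
  g.isMetricAt_coordMetric x (mem_extChartAt_target x)

theorem PseudoMetric.det_gram_ne_zero (g : PseudoMetric M) (x : M) : (g.gram x).det ≠ 0 := by
  rw [← g.coordMetric_self]
  exact (g.isMetricAt_self x).det_ne_zero

theorem PseudoMetric.isSymm_gram (g : PseudoMetric M) (x : M) : (g.gram x).IsSymm :=
  Matrix.IsSymm.ext fun _ _ ↦ g.symm _ _ _

theorem PseudoMetric.det_gramC (g : PseudoMetric M) (x : M) :
    (g.gramC x).det = ((g.gram x).det : ℂ) :=
  (Complex.ofRealHom.map_det (g.gram x)).symm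

theorem sdEigenvalue_sq (g : PseudoMetric M) (x : M) :
    sdEigenvalue g x * sdEigenvalue g x * (g.gram x).det = (|(g.gram x).det| : ℝ) := by
  rw [sdEigenvalue]
  split_ifs with h
  · rw [abs_of_pos h]; ring
  · rw [abs_of_nonpos (not_lt.1 h), Complex.I_mul_I]; push_cast; ring

/-- There is a null frame, the columns of `P`, oriented such that `2`-forms of chirality `χ` are
those with eigenvalue `-1` for the Hodge star in the frame. -/
theorem exists_adaptedFrame (g : PseudoMetric M) (o : ManifoldOrientation M) (χ : Chirality)
    (x : M) : ∃ P : Matrix (Fin 4) (Fin 4) ℂ, P.transpose * g.gramC x * P = nullGram ∧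
      volumeCoeff g o x * P.det = -(χ.sign * sdEigenvalue g x) := by
  obtain ⟨P, hP⟩ : ∃ P : Matrix (Fin 4) (Fin 4) ℂ, P.transpose * g.gramC x * P = nullGram :=
    exists_nullFrame (g.isSymm_gram x) (g.det_gram_ne_zero x)
  have hdet : P.det * P.det * (g.gram x).det = 1 := by
    have := congrArg Matrix.det hP
    rw [Matrix.det_mul, Matrix.det_mul, Matrix.det_transpose, det_nullGram] at this
    rw [← g.det_gramC]
    linear_combination this
  have hv : volumeCoeff g o x * volumeCoeff g o x = |(g.gram x).det| := by
    rw [volumeCoeff]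
    have := Real.mul_self_sqrt (abs_nonneg (g.gram x).det)
    split_ifs <;> linear_combination this
  have hvC : (volumeCoeff g o x : ℂ) * volumeCoeff g o x = (|(g.gram x).det| : ℝ) := by
    exact_mod_cast hv
  have hne : ((g.gram x).det : ℂ) ≠ 0 := by exact_mod_cast g.det_gram_ne_zero x
  have hχ : χ.sign * χ.sign = 1 := by cases χ <;> simp [Chirality.sign]
  have hsq : (volumeCoeff g o x * P.det) * (volumeCoeff g o x * P.det) =
      (χ.sign * sdEigenvalue g x) * (χ.sign * sdEigenvalue g x) := by
    refine mul_right_cancel₀ hne ?_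
    have h1 := sdEigenvalue_sq g x
    linear_combination (volumeCoeff g o x : ℂ) * volumeCoeff g o x * hdet + hvC -
      χ.sign * χ.sign * h1 - (|(g.gram x).det| : ℝ) * hχ
  rcases mul_self_eq_mul_self_iff.1 hsq with h | h
  · -- exchanging the first two frame vectors reverses the orientation
    let S : Matrix (Fin 4) (Fin 4) ℂ := !![0, 1, 0, 0; 1, 0, 0, 0; 0, 0, 1, 0; 0, 0, 0, 1]
    have hS : S.transpose * nullGram * S = nullGram := by
      ext i j
      fin_cases i <;> fin_cases j <;>
        simp [S, nullGram, Matrix.mul_apply, Fin.sum_univ_four]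
    have hSd : S.det = -1 := by
      simp [S, Matrix.det_succ_row_zero, Fin.sum_univ_succ, Fin.succAbove]
    refine ⟨P * S, ?_, ?_⟩
    · calc (P * S).transpose * g.gramC x * (P * S) =
            S.transpose * (P.transpose * g.gramC x * P) * S := by
            simp only [Matrix.transpose_mul, Matrix.mul_assoc]
        _ = nullGram := by
            rw [hP, hS]
    · rw [Matrix.det_mul, hSd, ← h]; ring
  · exact ⟨P, hP, h⟩

section Frame

variable {g : PseudoMetric M} {x : M} {P : Matrix (Fin 4) (Fin 4) ℂ}

theorem isUnit_det_frame (hP : P.transpose * g.gramC x * P = nullGram) : IsUnit P.det := by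
  have := congrArg Matrix.det hP
  rw [Matrix.det_mul, det_nullGram] at this
  exact isUnit_iff_ne_zero.2 (right_ne_zero_of_mul_eq_one this)

theorem frame_mul_nullGram_mul (hP : P.transpose * g.gramC x * P = nullGram) :
    P * nullGram * P.transpose = ((g.gram x)⁻¹).map Complex.ofReal := by
  have hu := isUnit_det_frame hP
  have h1 : P * nullGram * P.transpose * g.gramC x = 1 := by
    calc P * nullGram * P.transpose * g.gramC x
        = P * nullGram * (P.transpose * g.gramC x * P) * P⁻¹ := by
          simp only [Matrix.mul_assoc, Matrix.mul_nonsing_inv P hu, Matrix.mul_one]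
      _ = 1 := by
          rw [hP, Matrix.mul_assoc P, nullGram_mul_self, Matrix.mul_one,
            Matrix.mul_nonsing_inv P hu]
  have h2 : g.gramC x * ((g.gram x)⁻¹).map Complex.ofReal = 1 := by
    have := congrArg (fun A : Matrix (Fin 4) (Fin 4) ℝ ↦ A.map Complex.ofRealHom)
      (Matrix.mul_nonsing_inv (g.gram x) (isUnit_iff_ne_zero.2 (g.det_gram_ne_zero x)))
    simp only [Matrix.map_mul] at this
    rw [Matrix.map_one _ (map_zero _) (map_one _)] at this
    exact this
  calc P * nullGram * P.transpose
      = P * nullGram * P.transpose * (g.gramC x * ((g.gram x)⁻¹).map Complex.ofReal) := by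
        rw [h2, Matrix.mul_one]
    _ = _ := by rw [← Matrix.mul_assoc, h1, Matrix.one_mul]

theorem eq_zero_of_frame_eq_zero (hP : P.transpose * g.gramC x * P = nullGram)
    {N : Matrix (Fin 4) (Fin 4) ℂ} (hN : P.transpose * N * P = 0) : N = 0 := by
  have hu := isUnit_det_frame hP
  have hu' : IsUnit P.transpose.det := by rwa [Matrix.det_transpose]
  calc N = P.transpose⁻¹ * (P.transpose * N * P) * P⁻¹ := by
        rw [Matrix.mul_assoc P.transpose, Matrix.nonsing_inv_mul_cancel_left _ _ hu',
          Matrix.mul_nonsing_inv_cancel_right _ _ hu]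
    _ = 0 := by rw [hN]; simp

/-- The eigenvalue equation for the Hodge star can be checked in a null frame. -/
theorem hodge_eq_of_nullHodge (o : ManifoldOrientation M)
    (hP : P.transpose * g.gramC x * P = nullGram) {W : Matrix (Fin 4) (Fin 4) ℂ} {c : ℂ}
    (hW : ((volumeCoeff g o x : ℂ) * P.det) • nullHodge (P.transpose * W * P) =
      c • (P.transpose * W * P)) (a b : Fin 4) :
    hodge g o x W a b = c * W a b := by
  set H : Matrix (Fin 4) (Fin 4) ℂ := ((g.gram x)⁻¹).map Complex.ofReal with hH
  have hodgeM : ∀ a b, hodge g o x W a b =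
      (volumeCoeff g o x : ℂ) * epsContract (H * W * H.transpose) a b := by
    intro a b
    simp only [hodge, epsContract, Matrix.of_apply, Complex.ofReal_mul, volumeForm_tangentBasis,
      Matrix.mul_apply, Matrix.transpose_apply, Finset.mul_sum, Finset.sum_mul]
    refine Finset.sum_congr rfl fun c _ ↦ Finset.sum_congr rfl fun d _ ↦ ?_
    rw [Finset.sum_comm]
    refine Finset.sum_congr rfl fun e _ ↦ Finset.sum_congr rfl fun f _ ↦ ?_
    simp only [hH, Matrix.map_apply]
    ring
  have hHW : H * W * H.transpose =
      P * (nullGram * (P.transpose * W * P) * nullGram) * P.transpose := by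
    rw [hH, ← frame_mul_nullGram_mul hP]
    simp only [Matrix.transpose_mul, Matrix.transpose_transpose, transpose_nullGram,
      Matrix.mul_assoc]
  have key : (volumeCoeff g o x : ℂ) • epsContract (H * W * H.transpose) - c • W = 0 := by
    refine eq_zero_of_frame_eq_zero hP ?_
    rw [Matrix.mul_sub, Matrix.sub_mul, Matrix.mul_smul, Matrix.smul_mul, Matrix.mul_smul,
      Matrix.smul_mul, hHW, epsContract_frame, smul_smul, ← hW, nullHodge, sub_self]
  have := congrFun (congrFun key a) b
  rw [Matrix.sub_apply, Matrix.smul_apply, Matrix.smul_apply, Matrix.zero_apply, smul_eq_mul,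
    smul_eq_mul] at this
  rw [hodgeM]
  linear_combination this

end Frame

end Chirality

/-! ### Para-Hermitian structures with prescribed eigenplanes -/

/-- In a null frame `(l, n, m, m')`, the involution which is `1` on the plane spanned by
`l + t m'` and `m - t n`, and `-1` on the plane spanned by `l + s m'` and `m - s n`. -/
def paraMatrix (t s : ℂ) : Matrix (Fin 4) (Fin 4) ℂ :=
  (s - t)⁻¹ • !![s + t, 0, 0, -2; 0, -(s + t), -(2 * t * s), 0; 0, 2, s + t, 0;
    2 * t * s, 0, 0, -(s + t)]

section paraMatrix

variable {t s : ℂ}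

theorem paraMatrix_mul_self (h : t ≠ s) : paraMatrix t s * paraMatrix t s = 1 := by
  have hne : s - t ≠ 0 := sub_ne_zero.2 h.symm
  rw [paraMatrix, Matrix.smul_mul, Matrix.mul_smul, smul_smul]
  ext i j
  fin_cases i <;> fin_cases j <;>
    simp [hne] <;> field_simp <;> ring

/-- `paraMatrix t s` is an anti-isometry, since its eigenplanes are totally null. -/
theorem paraMatrix_transpose_mul (h : t ≠ s) :
    (paraMatrix t s).transpose * nullGram * paraMatrix t s = -nullGram := by
  have hne : s - t ≠ 0 := sub_ne_zero.2 h.symm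
  rw [paraMatrix, Matrix.transpose_smul, Matrix.smul_mul, Matrix.smul_mul, Matrix.mul_smul,
    smul_smul]
  ext i j
  fin_cases i <;> fin_cases j <;>
    simp [nullGram, Matrix.mul_apply, Fin.sum_univ_four, hne] <;> field_simp <;> ring

theorem paraMatrix_mulVec (h : t ≠ s) :
    (paraMatrix t s).mulVec ![1, 0, 0, t] = ![1, 0, 0, t] ∧
      (paraMatrix t s).mulVec ![0, -t, 1, 0] = ![0, -t, 1, 0] ∧
      (paraMatrix t s).mulVec ![1, 0, 0, s] = -![1, 0, 0, s] ∧
      (paraMatrix t s).mulVec ![0, -s, 1, 0] = -![0, -s, 1, 0] := by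
  have hne : s - t ≠ 0 := sub_ne_zero.2 h.symm
  refine ⟨?_, ?_, ?_, ?_⟩ <;> ext i <;> fin_cases i <;>
    simp [paraMatrix, Matrix.mulVec, dotProduct, Fin.sum_univ_four] <;> field_simp <;> ring

/-- An involution anticommuting with `paraMatrix t s`; it exchanges the two eigenplanes. -/
theorem exists_anticommuting (t s : ℂ) : ∃ J : Matrix (Fin 4) (Fin 4) ℂ, J * J = 1 ∧
    J * paraMatrix t s = -(paraMatrix t s * J) := by
  refine ⟨!![1, 0, 0, 0; 0, -1, -(s + t), 0; 0, 0, 1, 0; s + t, 0, 0, -1], ?_, ?_⟩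
  · ext i j
    fin_cases i <;> fin_cases j <;> simp [Matrix.mul_apply, Fin.sum_univ_four]
  · rw [paraMatrix, Matrix.smul_mul, Matrix.mul_smul, ← smul_neg]
    congr 1
    ext i j
    fin_cases i <;> fin_cases j <;> simp [Matrix.mul_apply, Fin.sum_univ_four] <;> ring

/-- The fundamental `2`-form of `paraMatrix t s` is anti-self-dual in the null frame. -/
theorem nullHodge_paraMatrix (t s : ℂ) :
    nullHodge ((paraMatrix t s).transpose * nullGram) =
      -((paraMatrix t s).transpose * nullGram) := by
  rw [paraMatrix, Matrix.transpose_smul, Matrix.smul_mul]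
  apply nullHodge_eq_neg
  · intro a b
    fin_cases a <;> fin_cases b <;>
      simp [nullGram, Matrix.mul_apply, Fin.sum_univ_four] <;> ring
  all_goals simp [nullGram, Matrix.mul_apply, Fin.sum_univ_four]

end paraMatrix

section Pointwise

variable {M : Type*} [TopologicalSpace M] [ChartedSpace E4 M]

/-- The endomorphism of `T_x M ⊗ ℂ` with matrix `A`. -/
def endOfMatrix (x : M) (A : Matrix (Fin 4) (Fin 4) ℂ) :
    Module.End ℂ (ℂ ⊗[ℝ] TangentSpace (𝓡 4) x) :=
  Matrix.toLin (Algebra.TensorProduct.basis ℂ (tangentBasis x))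
    (Algebra.TensorProduct.basis ℂ (tangentBasis x)) A

theorem ofComplexCoord_eq (x : M) (u : Fin 4 → ℂ) :
    ofComplexCoord x u = (Algebra.TensorProduct.basis ℂ (tangentBasis x)).equivFun.symm u := by
  rw [Module.Basis.equivFun_symm_apply, ofComplexCoord]
  refine Finset.sum_congr rfl fun a _ ↦ ?_
  rw [Algebra.TensorProduct.basis_apply, TensorProduct.smul_tmul', smul_eq_mul, mul_one]

theorem exists_ofComplexCoord (x : M) (z : ℂ ⊗[ℝ] TangentSpace (𝓡 4) x) :
    ∃ u, ofComplexCoord x u = z :=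
  ⟨(Algebra.TensorProduct.basis ℂ (tangentBasis x)).equivFun z, by
    rw [ofComplexCoord_eq, LinearEquiv.symm_apply_apply]⟩

theorem ofComplexCoord_neg (x : M) (u : Fin 4 → ℂ) :
    ofComplexCoord x (-u) = -ofComplexCoord x u := by
  rw [ofComplexCoord_eq, ofComplexCoord_eq, map_neg]

theorem endOfMatrix_apply (x : M) (A : Matrix (Fin 4) (Fin 4) ℂ) (u : Fin 4 → ℂ) :
    endOfMatrix x A (ofComplexCoord x u) = ofComplexCoord x (A.mulVec u) := by
  have hu : ⇑((Algebra.TensorProduct.basis ℂ (tangentBasis x)).repr (ofComplexCoord x u)) = u := by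
    rw [ofComplexCoord_eq, ← Module.Basis.equivFun_apply, LinearEquiv.apply_symm_apply]
  rw [endOfMatrix, Matrix.toLin_apply, hu, ofComplexCoord_eq, Module.Basis.equivFun_symm_apply]

theorem endOfMatrix_mul (x : M) (A B : Matrix (Fin 4) (Fin 4) ℂ) :
    endOfMatrix x (A * B) = endOfMatrix x A * endOfMatrix x B :=
  Matrix.toLin_mul _ _ _ A B

theorem endOfMatrix_one (x : M) : endOfMatrix x 1 = 1 := Matrix.toLin_one _

theorem endOfMatrix_neg (x : M) (A : Matrix (Fin 4) (Fin 4) ℂ) :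
    endOfMatrix x (-A) = -endOfMatrix x A := map_neg _ _

theorem ofComplexCoord_single (x : M) (a : Fin 4) :
    ofComplexCoord x (Pi.single a 1) = (1 : ℂ) ⊗ₜ[ℝ] tangentBasis x a := by
  rw [ofComplexCoord_eq, Module.Basis.equivFun_symm_apply]
  simp [Pi.single_apply]

/-- The eigenspaces of an involution have the same dimension if another involution anticommutes
with it. -/
theorem finrank_eigenspace_eq {W : Type*} [AddCommGroup W] [Module ℂ W] {K J : Module.End ℂ W}
    (hJ : J * J = 1) (hJK : J * K = -(K * J)) :
    Module.finrank ℂ (K.eigenspace 1) = Module.finrank ℂ (K.eigenspace (-1)) := by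
  have hJJ : ∀ v, J (J v) = v := fun v ↦ by rw [← Module.End.mul_apply, hJ, Module.End.one_apply]
  have hKJ : ∀ v, K (J v) = -J (K v) := fun v ↦ by
    rw [← Module.End.mul_apply, ← Module.End.mul_apply, hJK]; simp
  have hmap : ∀ c : ℂ, ∀ v ∈ K.eigenspace c, J v ∈ K.eigenspace (-c) := fun c v hv ↦ by
    rw [Module.End.mem_eigenspace_iff] at hv ⊢
    rw [hKJ, hv, map_smul, neg_smul]
  have hmap' : ∀ v ∈ K.eigenspace (-1), J v ∈ K.eigenspace 1 := fun v hv ↦ by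
    simpa using hmap _ v hv
  exact LinearEquiv.finrank_eq (LinearEquiv.ofLinearMap (J.restrict (hmap 1)) (J.restrict hmap')
    (LinearMap.ext fun v ↦ Subtype.ext (hJJ v)) (LinearMap.ext fun v ↦ Subtype.ext (hJJ v)))

variable [IsManifold (𝓡 4) ∞ M]

theorem PseudoMetric.complexified_ofComplexCoord (g : PseudoMetric M) (x : M) (u w : Fin 4 → ℂ) :
    g.complexified x (ofComplexCoord x u) (ofComplexCoord x w) =
      u ⬝ᵥ (g.gramC x).mulVec w := by
  rw [← g.pair_complexCoord, complexCoord_ofComplexCoord, complexCoord_ofComplexCoord]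
  simp only [pair, dotProduct, Matrix.mulVec, Finset.mul_sum]
  exact Finset.sum_congr rfl fun a _ ↦ Finset.sum_congr rfl fun b _ ↦ by
    rw [gramC, Matrix.map_apply]; ring

theorem fundamentalForm_endOfMatrix (g : PseudoMetric M) (x : M) (A : Matrix (Fin 4) (Fin 4) ℂ)
    (a b : Fin 4) :
    fundamentalForm g x (endOfMatrix x A) a b = (A.transpose * g.gramC x) a b := by
  rw [fundamentalForm, ← ofComplexCoord_single, ← ofComplexCoord_single, endOfMatrix_apply,
    g.complexified_ofComplexCoord]
  simp [Matrix.mul_apply, dotProduct]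

/-- In an adapted null frame, `paraMatrix t s` is a para-Hermitian structure of chirality `χ`. -/
theorem isParaHermitianAt_paraMatrix {g : PseudoMetric M} {o : ManifoldOrientation M}
    {χ : Chirality} {x : M} {P : Matrix (Fin 4) (Fin 4) ℂ}
    (hP : P.transpose * g.gramC x * P = nullGram)
    (hχ : volumeCoeff g o x * P.det = -(χ.sign * sdEigenvalue g x)) {t s : ℂ} (h : t ≠ s) :
    IsParaHermitianAt g o χ x (endOfMatrix x (P * paraMatrix t s * P⁻¹)) := by
  have hu := isUnit_det_frame hP
  have hinv : P⁻¹ * P = 1 := Matrix.nonsing_inv_mul P hu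
  have hinv' : P * P⁻¹ = 1 := Matrix.mul_nonsing_inv P hu
  have conj_mul : ∀ A B : Matrix (Fin 4) (Fin 4) ℂ,
      (P * A * P⁻¹) * (P * B * P⁻¹) = P * (A * B) * P⁻¹ := by
    intro A B
    calc _ = P * A * (P⁻¹ * P) * B * P⁻¹ := by simp only [Matrix.mul_assoc]
      _ = _ := by rw [hinv, Matrix.mul_one]; simp only [Matrix.mul_assoc]
  set A := P * paraMatrix t s * P⁻¹ with hA
  have hAP : A * P = P * paraMatrix t s := by
    rw [hA, Matrix.mul_assoc, hinv, Matrix.mul_one]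
  have hGA : A.transpose * g.gramC x * A = -g.gramC x := by
    have : P.transpose * (A.transpose * g.gramC x * A + g.gramC x) * P = 0 := by
      calc _ = (A * P).transpose * g.gramC x * (A * P) + P.transpose * g.gramC x * P := by
            simp only [Matrix.transpose_mul, Matrix.mul_add, Matrix.add_mul, Matrix.mul_assoc]
        _ = (paraMatrix t s).transpose * (P.transpose * g.gramC x * P) * paraMatrix t s +
            P.transpose * g.gramC x * P := by
            rw [hAP]; simp only [Matrix.transpose_mul, Matrix.mul_assoc]
        _ = 0 := by rw [hP, paraMatrix_transpose_mul h, neg_add_cancel]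
    exact eq_neg_of_add_eq_zero_left (eq_zero_of_frame_eq_zero hP this)
  refine ⟨⟨?_, ?_, ?_⟩, fun a b ↦ ?_⟩
  · rw [← endOfMatrix_mul, hA, conj_mul, paraMatrix_mul_self h, Matrix.mul_one, hinv',
      endOfMatrix_one]
  · obtain ⟨J, hJ, hJK⟩ := exists_anticommuting t s
    refine finrank_eigenspace_eq (J := endOfMatrix x (P * J * P⁻¹)) ?_ ?_
    · rw [← endOfMatrix_mul, conj_mul, hJ, Matrix.mul_one, hinv', endOfMatrix_one]
    · rw [← endOfMatrix_mul, ← endOfMatrix_mul, ← endOfMatrix_neg, hA, conj_mul, conj_mul, hJK,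
        Matrix.mul_neg, Matrix.neg_mul]
  · intro X Y
    obtain ⟨u, rfl⟩ := exists_ofComplexCoord x X
    obtain ⟨w, rfl⟩ := exists_ofComplexCoord x Y
    rw [endOfMatrix_apply, endOfMatrix_apply, g.complexified_ofComplexCoord,
      g.complexified_ofComplexCoord, Matrix.dotProduct_mulVec, ← Matrix.vecMul_transpose,
      Matrix.vecMul_vecMul, ← Matrix.dotProduct_mulVec, Matrix.mulVec_mulVec, hGA,
      Matrix.neg_mulVec, dotProduct_neg]
  · have hW : P.transpose * (A.transpose * g.gramC x) * P =
        (paraMatrix t s).transpose * nullGram := by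
      calc _ = (A * P).transpose * g.gramC x * P := by
            simp only [Matrix.transpose_mul, Matrix.mul_assoc]
        _ = (paraMatrix t s).transpose * (P.transpose * g.gramC x * P) := by
            rw [hAP]; simp only [Matrix.transpose_mul, Matrix.mul_assoc]
        _ = _ := by rw [hP]
    have e : fundamentalForm g x (endOfMatrix x A) = A.transpose * g.gramC x :=
      funext fun a ↦ funext fun b ↦ fundamentalForm_endOfMatrix g x A a b
    rw [e]
    refine hodge_eq_of_nullHodge o hP ?_ a b
    rw [hW, nullHodge_paraMatrix, hχ, smul_neg, neg_smul, neg_neg]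

/-- If the `1`-eigenbundle of an anti-isometric involution of `TM ⊗ ℂ` is involutive, then
`C(X, Y, X, Y) = 0` for `X`, `Y` in it: the eigenbundle is totally null, so the Weyl tensor agrees
on it with the Riemann tensor, which vanishes. -/
theorem quad_weyl_eq_zero (g : PseudoMetric M) {x : M} {U : Set M} (hU : IsOpen U) (hxU : x ∈ U)
    {K : ComplexEndField M} (hsmooth : EndSmoothOn U K) (hsq : ∀ p ∈ U, K p * K p = 1)
    (hanti : ∀ p ∈ U, ∀ X Y, g.complexified p (K p X) (K p Y) = -g.complexified p X Y)
    (hinv : InvolutiveOn U fun p ↦ (K p).eigenspace 1) {X Y : Fin 4 → ℂ}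
    (hX : K x (ofComplexCoord x X) = ofComplexCoord x X)
    (hY : K x (ofComplexCoord x Y) = ofComplexCoord x Y) :
    quad (fun a b c d ↦ (weyl g x a b c d : ℂ)) X Y X Y = 0 := by
  have hnull : ∀ u w, K x (ofComplexCoord x u) = ofComplexCoord x u →
      K x (ofComplexCoord x w) = ofComplexCoord x w →
      pair (fun a b ↦ (coordMetric g x (extChartAt (𝓡 4) x x) a b : ℂ)) u w = 0 := by
    intro u w hu hw
    have h1 := hanti x hxU (ofComplexCoord x u) (ofComplexCoord x w)
    have h2 := g.pair_complexCoord x (ofComplexCoord x u) (ofComplexCoord x w)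
    rw [complexCoord_ofComplexCoord, complexCoord_ofComplexCoord] at h2
    rw [hu, hw] at h1
    rw [g.coordMetric_self, h2]
    linear_combination (1 / 2 : ℂ) * h1
  have := sum_weylCoord_eq_sum_riemann X Y (hnull X X hX hX) (hnull X Y hX hY) (hnull Y X hY hX)
    (hnull Y Y hY hY)
  rw [quad]
  exact this.trans (sum_riemann_eq_zero g hU hxU hsmooth hsq hanti hinv hX hY)

theorem EndSmoothOn.neg {U : Set M} {K : ComplexEndField M} (hK : EndSmoothOn U K) :
    EndSmoothOn U fun p ↦ -K p := by
  intro V hV hVU X hX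
  have := hK V hV hVU X hX
  constructor
  · simpa only [LinearMap.neg_apply, map_neg] using! this.1.neg_section
  · simpa only [LinearMap.neg_apply, map_neg] using! this.2.neg_section

theorem isWeylTensor_weyl (g : PseudoMetric M) (x : M) :
    IsWeylTensor (((g.gram x)⁻¹).map Complex.ofReal)
      (fun a b c d ↦ (weyl g x a b c d : ℂ)) := by
  have h := (g.isMetricAt_self x).isWeylTensor
  rw [g.coordMetric_self] at h
  constructor
  · intro a b c d; exact_mod_cast h.swap_left a b c d
  · intro a b c d; exact_mod_cast h.swap_right a b c d
  · intro a b c d; exact_mod_cast h.pair_symm a b c d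
  · intro a b c d; exact_mod_cast h.bianchi a b c d
  · intro b d
    simp only [Matrix.map_apply]
    exact_mod_cast h.trace b d

/-- A tensor annihilating, in a null frame, the bivectors `l ∧ m`, `n ∧ m'` and
`l ∧ n + m ∧ m'` takes values, in its first two indices, in the forms fixed by the Hodge star of
the frame. -/
theorem nullHodge_frame_eq_self {g : PseudoMetric M} {x : M} {P h : Matrix (Fin 4) (Fin 4) ℂ}
    (hP : P.transpose * g.gramC x * P = nullGram) {C : Fin 4 → Fin 4 → Fin 4 → Fin 4 → ℂ}
    (hC : IsWeylTensor h C)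
    (hz : ∀ c d, frameTensor P C 0 2 c d = 0 ∧ frameTensor P C 1 3 c d = 0 ∧
      frameTensor P C 0 1 c d = -frameTensor P C 2 3 c d) (c d : Fin 4) :
    nullHodge (P.transpose * Matrix.of (fun a b ↦ C a b c d) * P) =
      P.transpose * Matrix.of (fun a b ↦ C a b c d) * P := by
  -- `N i j` is the `2`-form obtained by contracting the first two indices with frame vectors
  let N : Fin 4 → Fin 4 → Matrix (Fin 4) (Fin 4) ℂ := fun i j ↦
    Matrix.of fun c d ↦ ∑ a, ∑ b, C a b c d * P a i * P b j
  have hN : ∀ i j, (P.transpose * Matrix.of (fun a b ↦ C a b c d) * P) i j = N i j c d := by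
    intro i j
    simp only [N, Matrix.mul_apply, Matrix.of_apply, Matrix.transpose_apply, Finset.sum_mul]
    rw [Finset.sum_comm]
    exact Finset.sum_congr rfl fun a _ ↦ Finset.sum_congr rfl fun b _ ↦ by ring
  have hPN : ∀ i j k l, (P.transpose * N i j * P) k l = frameTensor P C i j k l := by
    intro i j k l
    have swap : ∑ p : Fin 4 × Fin 4, ∑ q : Fin 4 × Fin 4,
        C p.1 p.2 q.1 q.2 * P p.1 i * P p.2 j * P q.1 k * P q.2 l =
        ∑ q : Fin 4 × Fin 4, ∑ p : Fin 4 × Fin 4,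
        C p.1 p.2 q.1 q.2 * P p.1 i * P p.2 j * P q.1 k * P q.2 l := Finset.sum_comm
    simp only [Fintype.sum_prod_type] at swap
    rw [frameTensor, quad, swap]
    simp only [N, Matrix.mul_apply, Matrix.of_apply, Matrix.transpose_apply, Finset.sum_mul,
      Finset.mul_sum]
    rw [Finset.sum_comm]
    refine Finset.sum_congr rfl fun c _ ↦ Finset.sum_congr rfl fun d _ ↦
      Finset.sum_congr rfl fun a _ ↦ Finset.sum_congr rfl fun b _ ↦ by ring
  have h02 : N 0 2 = 0 := eq_zero_of_frame_eq_zero hP <| by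
    ext k l; rw [hPN]; exact (hz k l).1
  have h13 : N 1 3 = 0 := eq_zero_of_frame_eq_zero hP <| by
    ext k l; rw [hPN]; exact (hz k l).2.1
  have h01 : N 0 1 + N 2 3 = 0 := eq_zero_of_frame_eq_zero hP <| by
    rw [Matrix.mul_add, Matrix.add_mul]
    ext k l
    rw [Matrix.add_apply, hPN, hPN, (hz k l).2.2]
    simp
  apply nullHodge_eq_self
  · intro i j
    rw [hN, hN]
    simp only [N, Matrix.of_apply, ← Finset.sum_neg_distrib]
    rw [Finset.sum_comm]
    refine Finset.sum_congr rfl fun a _ ↦ Finset.sum_congr rfl fun b _ ↦ ?_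
    rw [hC.swap_left]; ring
  · rw [hN, hN]
    exact eq_neg_of_add_eq_zero_left (congrFun (congrFun h01 c) d)
  · rw [hN, h02]; rfl
  · rw [hN, h13]; rfl

end Pointwise

end ParaHermitian

end

open ParaHermitian in
theorem mainTheorem5 {M : Type*} [TopologicalSpace M] [T2Space M] [ChartedSpace E4 M]
    [IsManifold (𝓡 4) ∞ M] (g : PseudoMetric M) (o : ManifoldOrientation M) (χ : Chirality)
    (h : ∀ (x : M) (Kx : Module.End ℂ (ℂ ⊗[ℝ] TangentSpace (𝓡 4) x)),
      IsParaHermitianAt g o χ x Kx →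
      ∃ (U : Set M) (K : ComplexEndField M), IsOpen U ∧ x ∈ U ∧
        IsAlmostParaHermitianOn g U K ∧ HalfIntegrableOn U K ∧ K x = Kx) :
    WeylIsDual g o χ.opposite := by
  intro x c d
  obtain ⟨P, hP, hχ⟩ := exists_adaptedFrame g o χ x
  have hC := isWeylTensor_weyl g x
  have hinv : P⁻¹ * P = 1 := Matrix.nonsing_inv_mul P (isUnit_det_frame hP)
  have hquartic : ∀ t s : ℂ, t ≠ s →
      quad (frameTensor P fun a b c d ↦ (weyl g x a b c d : ℂ))
        ![1, 0, 0, t] ![0, -t, 1, 0] ![1, 0, 0, t] ![0, -t, 1, 0] = 0 ∨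
      quad (frameTensor P fun a b c d ↦ (weyl g x a b c d : ℂ))
        ![1, 0, 0, s] ![0, -s, 1, 0] ![1, 0, 0, s] ![0, -s, 1, 0] = 0 := by
    intro t s hts
    obtain ⟨U, K, hU, hxU, hK, hhalf, hKx⟩ := h x _ (isParaHermitianAt_paraMatrix hP hχ hts)
    have happ : ∀ u, K x (ofComplexCoord x (P.mulVec u)) =
        ofComplexCoord x (P.mulVec ((paraMatrix t s).mulVec u)) := by
      intro u
      rw [hKx, endOfMatrix_apply, Matrix.mulVec_mulVec, Matrix.mulVec_mulVec, Matrix.mul_assoc,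
        hinv, Matrix.mul_one]
    obtain ⟨h1, h2, h3, h4⟩ := paraMatrix_mulVec hts
    rw [frameTensor_quad, frameTensor_quad]
    rcases hhalf with hhalf | hhalf
    · left
      exact quad_weyl_eq_zero g hU hxU hK.smooth (fun p hp ↦ (hK.paraHermitian p hp).sq_eq_one)
        (fun p hp ↦ (hK.paraHermitian p hp).anti_isometry) hhalf (by rw [happ, h1])
        (by rw [happ, h2])
    · -- the `-1`-eigenbundle of `K` is the `1`-eigenbundle of `-K`
      right
      have heig : (fun p ↦ (K p).eigenspace (-1)) = fun p ↦ (-K p).eigenspace 1 := by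
        funext p
        ext v
        rw [Module.End.mem_eigenspace_iff, Module.End.mem_eigenspace_iff, one_smul, neg_smul,
          one_smul, LinearMap.neg_apply, neg_eq_iff_eq_neg]
      rw [heig] at hhalf
      refine quad_weyl_eq_zero g hU hxU (K := fun p ↦ -K p) hK.smooth.neg (fun p hp ↦ ?_)
        (fun p hp X Y ↦ ?_) hhalf ?_ ?_
      · exact (neg_mul_neg (K p) (K p)).trans (hK.paraHermitian p hp).sq_eq_one
      · simpa using (hK.paraHermitian p hp).anti_isometry X Y
      · rw [LinearMap.neg_apply, happ, h3, Matrix.mulVec_neg, ofComplexCoord_neg, neg_neg]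
      · rw [LinearMap.neg_apply, happ, h4, Matrix.mulVec_neg, ofComplexCoord_neg, neg_neg]
  have hz := (hC.frameTensor (frame_mul_nullGram_mul hP)).components_eq_zero hquartic
  refine hodge_eq_of_nullHodge o hP (W := Matrix.of fun a b ↦ (weyl g x a b c d : ℂ)) ?_
  rw [nullHodge_frame_eq_self hP hC hz, hχ]
  congr 1
  cases χ <;> simp [Chirality.opposite, Chirality.sign]
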